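/- **Setting.** Let $X=\mathbb Z\times[0,1]^{\mathbb N}$ with $\lambda$ = counting measure times the infinite product of Lebesgue measures. A *microcosm* is a monoid of maps $X\to X$ that are measurable, send measurable sets to measurable sets, and are non-singular ($\lambda(f(A))=0\iff\lambda(A)=0$). $\mathfrak m_\infty$ is the microcosm generated by the translations $(x,s)\mapsto(x+z,s)$, $z\in\mathbb Z$, and the permutations of finitely many coordinates of $s$. Weights are elements of $[0,1]\times\{0,1\}$; $(a,0)$ is written $a$, $(a,1)$ is written $a\cdot\mathbf 1$; the product is the usual one on $[0,1]$, and a product is marked by $\mathbf 1$ as soon as one of its factors is; $m(x,y)=xy$. A *graphing* $F$ consists of a measurable support $V^F\subseteq X$, a dialect (set of control states) $D^F$, and countably many edges $e$, each with a measurable source $S_e\subseteq V^F$, a measurable realiser $\phi_e$ with $\phi_e(S_e)\subseteq V^F$, states $i_e,o_e\in D^F$ and a weight $\omega_e$; it is an $\mathfrak m$-graphing if all $\phi_e\in\mathfrak m$, and it is *finite* if it refines a graphing with finitely many edges. An *alternating path* between $F$ and $H$ is a non-empty sequence $\pi=e_1\dots e_n$ of edges taken alternately in $F$ and $H$, with $o_{e_i}=i_{e_{i+2}}$,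 such that $S_\pi=\{x:\phi_{e_i}\cdots\phi_{e_1}(x)\in S_{e_{i+1}}\text{ for all }0\le i<n\}$ is not negligible; put $\phi_\pi=\phi_{e_n}\cdots\phi_{e_1}$ and $\omega_\pi=\prod\omega_{e_i}$. It is *closed* if moreover $e_1$ may follow $e_n$, with matching states (indices read cyclically). The *execution* $F\bowtie H$ has support $V^F\mathbin{\triangle}V^H$, dialect $D^F\times D^H$, and as edges all alternating paths $\pi$, realised by $\phi_\pi$, with weight $\omega_\pi$ and source $S_\pi\cap\overline C\cap\phi_\pi^{-1}(\overline C)$, where $C=V^F\cap V^H$. For disjoint supports, $F\otimes H$ is the disjoint union, with dialect $D^F\times D^H$. The measurement is $$[\![F,H]\!]=\sum_\pi\int_{\mathrm{supp}(\pi)}\frac{m(\omega_\pi^{\rho_\pi(x)})}{\rho_\pi(x)}\,d\lambda(x),$$ over representatives $\pi$ of the closed alternating paths that are not proper powers, modulo cyclic permutation; here $\mathrm{supp}(\pi)=\{x:\phi_\pi^k(x)\in S_\pi\ \forall k\ge0\}$, $\rho_\pi(x)=\inf\{n\ge1:\phi_\pi^n(x)=x\}$, and the integrand is $0$ where $\rho_\pi(x)=\infty$.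 A *project* of support $V$ is a pair $(a,\sum_i\alpha_iA_i)$ of a real number and a finite formal real combination of graphings of support $V$, realised by measure-preserving non-singular transformations that preserve measurability. Measurement and execution extend to projects by $$[\![(a,\textstyle\sum\alpha_iA_i),(b,\sum\beta_jB_j)]\!]=a\sum\beta_j+b\sum\alpha_i+\sum\alpha_i\beta_j[\![A_i,B_j]\!],$$ $$\mathfrak a\bowtie\mathfrak b=\big([\![\mathfrak a,\mathfrak b]\!],\textstyle\sum\alpha_i\beta_j\,A_i\bowtie B_j\big).$$ Two projects are *orthogonal* if they have the same support and their measurement is neither $0$ nor infinite; a graphing $A$ is identified with $(0,A)$. The orthogonal of a set of projects is the set of the projects orthogonal to all its elements. Let $\Sigma=\{0,1\}$, and let $\Psi$ be an injection of $\big((\Sigma\cup\{\star\})\times\{\mathrm{in},\mathrm{out}\}\big)\cup\{\mathrm a,\mathrm r\}$ into $\mathbb Z$; write $[f]=\{\Psi(f)\}\times[0,1]^{\mathbb N}$. For a word $w=a_1\dots a_k$ over $\Sigma$ put $a_0=\star$. A *word graphing* $W$ of $w$ has as support the union of all $[(a,d)]$, $a\in\Sigma\cup\{\star\}$, $d\in\{\mathrm{in},\mathrm{out}\}$,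 as dialect $\{0,\dots,n\}$ for some $n\geq k$, and, for an injection $\iota:\{0,\dots,k\}\to\{0,\dots,n\}$ and each $i\in\mathbb Z/(k+1)$, edges of weight $1$, realised by integer translations, from $[(a_i,\mathrm{out})]$ in state $\iota(i)$ to $[(a_{i+1},\mathrm{in})]$ in state $\iota(i+1)$, and from $[(a_i,\mathrm{in})]$ in state $\iota(i)$ to $[(a_{i-1},\mathrm{out})]$ in state $\iota(i-1)$. Fix a measure-preserving measurable bijection $[\cdot,\cdot]:[0,1]^2\to[0,1]$. The *word representation* $!W$ has the same support, a one-element dialect, and, with $N=n+1$, for each edge of $W$ with source $S$, realiser $\phi$ and states $d\to d'$, an edge of the same weight with source $\{(a,[x,y]\cdot s):(a,s)\in S,\ d\le Nx\le d+1\}$ and realiser $(a,[x,y]\cdot s)\mapsto(a',[x+\tfrac{d'-d}N\bmod 1,\,y]\cdot s')$, where $(a',s')=\phi(a,s)$. Let $!\mathrm{List}$ be the bi-orthogonal of the set of all projects $(0,!W)$, over all words. An *$\mathfrak m$-machine* is a finite $\mathfrak m$-graphing $G$ with finite dialect, all weights equal to $1$, and support the union of all the sets $[f]$, such that $G\bowtie\mathfrak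 a$ is a project of support $[\mathrm a]\cup[\mathrm r]$ for all $\mathfrak a\in{!\mathrm{List}}$. Let $\mathrm{Id}_{[\mathrm r]}$ be the graphing of support $[\mathrm a]\cup[\mathrm r]$ with one-element dialect and one edge, the identity on $[\mathrm r]$, of weight $1\cdot\mathbf 1$. The test $\mathcal T^-$ is the set of projects $(\zeta,\mathrm{Id}_{[\mathrm r]})$, $\zeta\in\mathbb R\setminus\{0\}$. **Proposition.** Let $\mathfrak m$ be a microcosm of measure-preserving maps, $G$ an $\mathfrak m$-machine and $!W$ a word representation. 1. $G\bowtie{!W}$ is orthogonal to every element of $\mathcal T^-$ if and only if there is no alternating cycle between $G$ and $!W\otimes\mathrm{Id}_{[\mathrm r]}$ passing through $[\mathrm r]$, i.e. no closed alternating path $\pi$ such that a non-negligible set of points $x\in S_\pi$ have a trajectory along $\pi$ that meets $[\mathrm r]$ and returns to its origin, $\phi_\pi(x)=x$. 2. If $\mathfrak m\subseteq\mathfrak m_\infty$, the equivalence in 1 also holds with the cycles understood without the condition $\phi_\pi(x)=x$, as the closed alternating paths $\pi$ such that, for every $k\ge1$, a non-negligible set of points in $S_{\pi^k}$ have a trajectory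 along $\pi$ that meets $[\mathrm r]$. -/

import Mathlib

open MeasureTheory Set
open scoped ENNReal

noncomputable section

namespace IGraph

/-! ### The space, microcosms -/

/-- The unit interval `[0,1]`. -/
abbrev I01 : Type := unitInterval

/-- The space `ℤ × [0,1]^ℕ`. -/
abbrev X : Type := ℤ × (ℕ → I01)

/-- Counting measure on `ℤ` times the infinite product of Lebesgue measures on `[0,1]`. -/
def vol : Measure X :=
  (Measure.count : Measure ℤ).prod (Measure.infinitePi (fun _ : ℕ => (volume : Measure I01)))

/-- `f` is measurable, preserves measurability of sets under direct images,
and is non-singular: `μ (f A) = 0` iff `μ A = 0`. -/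
structure IsTransformation (f : X → X) : Prop where
  measurable : Measurable f
  image : ∀ A, MeasurableSet A → MeasurableSet (f '' A)
  nonsingular : ∀ A, MeasurableSet A → (vol (f '' A) = 0 ↔ vol A = 0)

/-- A microcosm: a monoid of non-singular measurable-preserving transformations. -/
structure Microcosm where
  maps : Set (X → X)
  id_mem : id ∈ maps
  comp_mem : ∀ f ∈ maps, ∀ g ∈ maps, f ∘ g ∈ maps
  isTransformation : ∀ f ∈ maps, IsTransformation f

theorem IsTransformation.comp {f g : X → X} (hf : IsTransformation f)
    (hg : IsTransformation g) : IsTransformation (f ∘ g) where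
  measurable := hf.measurable.comp hg.measurable
  image A hA := by
    rw [image_comp]
    exact hf.image _ (hg.image _ hA)
  nonsingular A hA := by
    rw [image_comp, hf.nonsingular _ (hg.image _ hA), hg.nonsingular _ hA]

theorem IsTransformation.of_equiv (e : X ≃ᵐ X) (he : MeasurePreserving e vol vol) :
    IsTransformation e where
  measurable := e.measurable
  image A hA := by
    rw [e.measurableEmbedding.measurableSet_image]
    exact hA
  nonsingular A hA := by
    have h := he.measure_preimage (s := e '' A)
      (e.measurableEmbedding.measurableSet_image.2 hA).nullMeasurableSet
    rw [preimage_image_eq _ e.injective] at h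
    rw [h]

/-- The largest microcosm of measure-preserving maps: the ambient model. -/
def ambient : Microcosm where
  maps := {f | IsTransformation f ∧ MeasurePreserving f vol vol}
  id_mem := ⟨IsTransformation.of_equiv (MeasurableEquiv.refl X) (MeasurePreserving.id vol),
    MeasurePreserving.id vol⟩
  comp_mem _ hf _ hg := ⟨hf.1.comp hg.1, hf.2.comp hg.2⟩
  isTransformation _ hf := hf.1

/-- The translation `(x, s) ↦ (x + z, s)`. -/
def transl (z : ℤ) : X → X := fun p => (p.1 + z, p.2)

/-- The action of a permutation on sequences. -/
def permMap (σ : Equiv.Perm ℕ) : X → X := fun p => (p.1, fun k => p.2 (σ k))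

/-- The monoid generated by the integer translations and the permutations of the first `i`
coordinates (coordinates are numbered from `0`). -/
inductive Generated (i : ℕ) : (X → X) → Prop
  | id : Generated i id
  | transl (z : ℤ) : Generated i (transl z)
  | perm (σ : Equiv.Perm ℕ) (hσ : ∀ k, i ≤ k → σ k = k) : Generated i (permMap σ)
  | comp (f g : X → X) (hf : Generated i f) (hg : Generated i g) : Generated i (f ∘ g)

theorem measurePreserving_transl (z : ℤ) : MeasurePreserving (transl z) vol vol := by
  have h : MeasurePreserving (fun x : ℤ => x + z) Measure.count Measure.count :=
    ⟨measurable_of_countable _, by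
      ext s hs
      rw [Measure.map_apply (measurable_of_countable _) hs,
        Measure.count_apply hs, Measure.count_apply (measurable_of_countable _ hs)]
      congr 1
      exact Set.encard_preimage_of_bijective (Equiv.addRight z).bijective s⟩
  exact h.prod (MeasurePreserving.id _)

theorem measurePreserving_permMap (σ : Equiv.Perm ℕ) :
    MeasurePreserving (permMap σ) vol vol := by
  have hm : Measurable (fun (s : ℕ → I01) (k : ℕ) => s (σ k)) :=
    measurable_pi_lambda _ fun k => measurable_pi_apply _
  have h : MeasurePreserving (fun (s : ℕ → I01) (k : ℕ) => s (σ k))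
      (Measure.infinitePi (fun _ : ℕ => (volume : Measure I01)))
      (Measure.infinitePi (fun _ : ℕ => (volume : Measure I01))) := by
    refine ⟨hm, ?_⟩
    exact Measure.map_infinitePi_infinitePi_of_inj
      (P := fun _ : ℕ => (volume : Measure I01)) σ.injective
  exact (MeasurePreserving.id _).prod h

theorem Generated.exists_equiv {i : ℕ} {f : X → X} (h : Generated i f) :
    ∃ e : X ≃ᵐ X, ⇑e = f ∧ MeasurePreserving e vol vol := by
  induction h with
  | id => exact ⟨MeasurableEquiv.refl X, rfl, MeasurePreserving.id vol⟩
  | transl z =>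
    refine ⟨⟨⟨IGraph.transl z, IGraph.transl (-z), fun p => ?_, fun p => ?_⟩, ?_, ?_⟩, rfl,
      measurePreserving_transl z⟩
    · simp [IGraph.transl]
    · simp [IGraph.transl]
    · exact (measurePreserving_transl z).measurable
    · exact (measurePreserving_transl (-z)).measurable
  | perm σ hσ =>
    refine ⟨⟨⟨permMap σ, permMap σ.symm, fun p => ?_, fun p => ?_⟩, ?_, ?_⟩, rfl,
      measurePreserving_permMap σ⟩
    · simp [permMap]
    · simp [permMap]
    · exact (measurePreserving_permMap σ).measurable
    · exact (measurePreserving_permMap σ.symm).measurable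
  | comp f g hf hg ihf ihg =>
    obtain ⟨e, he, he'⟩ := ihf
    obtain ⟨d, hd, hd'⟩ := ihg
    refine ⟨d.trans e, ?_, he'.comp hd'⟩
    rw [← he, ← hd]
    rfl

theorem Generated.mono {i j : ℕ} (hij : i ≤ j) {f : X → X} (h : Generated i f) :
    Generated j f := by
  induction h with
  | id => exact .id
  | transl z => exact .transl z
  | perm σ hσ => exact .perm σ fun k hk => hσ k (hij.trans hk)
  | comp f g _ _ ihf ihg => exact .comp f g ihf ihg

/-- The microcosm `𝔪_i`. -/
def mMicrocosm (i : ℕ) : Microcosm where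
  maps := {f | Generated i f}
  id_mem := .id
  comp_mem f hf g hg := .comp f g hf hg
  isTransformation f hf := by
    obtain ⟨e, rfl, he⟩ := Generated.exists_equiv hf
    exact IsTransformation.of_equiv e he

/-- The microcosm `𝔪_∞`, the union of all the `𝔪_i`. -/
def mInfty : Microcosm where
  maps := ⋃ i : ℕ, (mMicrocosm i).maps
  id_mem := mem_iUnion.2 ⟨0, .id⟩
  comp_mem f hf g hg := by
    obtain ⟨i, hi⟩ := mem_iUnion.1 hf
    obtain ⟨j, hj⟩ := mem_iUnion.1 hg
    exact mem_iUnion.2 ⟨max i j, .comp f g (Generated.mono (le_max_left _ _) hi)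
      (Generated.mono (le_max_right _ _) hj)⟩
  isTransformation f hf := by
    obtain ⟨i, hi⟩ := mem_iUnion.1 hf
    exact (mMicrocosm i).isTransformation f hi

/-! ### Weights -/

/-- Weights `(a, y)` in `[0,1] × {0,1}`. The unmarked elements `(a, 0)` are written `a`,
the marked ones `(a, 1)` are written `a·𝟏`. -/
@[ext]
structure Weight where
  val : I01
  mark : Bool

/-- Multiplication on `[0,1]`; a product is marked as soon as one of its factors is. -/
instance : CommMonoid Weight where
  mul a b := ⟨a.val * b.val, a.mark || b.mark⟩
  one := ⟨1, false⟩
  mul_assoc a b c := Weight.ext (mul_assoc _ _ _) (Bool.or_assoc _ _ _)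
  one_mul a := Weight.ext (one_mul _) (Bool.false_or _)
  mul_one a := Weight.ext (mul_one _) (Bool.or_false _)
  mul_comm a b := Weight.ext (mul_comm _ _) (Bool.or_comm _ _)

/-- The parameter map `m (x, y) = x y`. -/
def Weight.param (a : Weight) : ℝ≥0∞ := if a.mark then ENNReal.ofReal (a.val : ℝ) else 0

/-! ### Graphings -/

/-- Weighted graphing representatives with set of control states (dialect) `D`. -/
structure Graphing (D : Type) where
  V : Set X
  measurableSet_V : MeasurableSet V
  E : Type
  countable_E : Countable E
  S : E → Set X
  measurableSet_S : ∀ e, MeasurableSet (S e)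
  S_subset : ∀ e, S e ⊆ V
  φ : E → X → X
  measurable_φ : ∀ e, Measurable (φ e)
  mapsTo : ∀ e, MapsTo (φ e) (S e) V
  inn : E → D
  out : E → D
  ω : E → Weight

/-- All edges are realised by elements of `𝔪`. -/
def Graphing.RealisedIn {D : Type} (G : Graphing D) (𝔪 : Microcosm) : Prop :=
  ∀ e, G.φ e ∈ 𝔪.maps

/-- `F` is a refinement of `G`: the map `p` gives the partition of the edges of `F`. -/
def Graphing.Refines {D : Type} (F G : Graphing D) : Prop :=
  F.V = G.V ∧ ∃ p : F.E → G.E,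
    (∀ e, (⋃ f ∈ p ⁻¹' {e}, F.S f) =ᵐ[vol] G.S e) ∧
    (∀ f f', p f = p f' → f ≠ f' → vol (F.S f ∩ F.S f') = 0) ∧
    ∀ f, F.ω f = G.ω (p f) ∧ F.φ f = G.φ (p f) ∧ F.inn f = G.inn (p f) ∧
      F.out f = G.out (p f)

/-- `G` refines a graphing with finitely many edges. -/
def Graphing.IsFinite {D : Type} (G : Graphing D) : Prop :=
  ∃ H : Graphing D, G.Refines H ∧ Finite H.E

/-! ### Alternating paths and execution -/

section Paths

variable {D D' : Type}

/-- One step of an alternating path: an edge of `F`, which leaves the control state in `D'`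
unchanged, or an edge of `G`, which leaves the control state in `D` unchanged. -/
abbrev Step (F : Graphing D) (G : Graphing D') : Type := (F.E × D') ⊕ (G.E × D)

namespace Step

variable {F : Graphing D} {G : Graphing D'}

/-- Control states before the step. -/
def src : Step F G → D × D'
  | .inl (e, d) => (F.inn e, d)
  | .inr (e, d) => (d, G.inn e)

/-- Control states after the step. -/
def tgt : Step F G → D × D'
  | .inl (e, d) => (F.out e, d)
  | .inr (e, d) => (d, G.out e)

/-- Source set of the edge. -/
def S : Step F G → Set X
  | .inl (e, _) => F.S e
  | .inr (e, _) => G.S e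

/-- Realiser of the edge. -/
def φ : Step F G → X → X
  | .inl (e, _) => F.φ e
  | .inr (e, _) => G.φ e

/-- Weight of the edge. -/
def ω : Step F G → Weight
  | .inl (e, _) => F.ω e
  | .inr (e, _) => G.ω e

/-- `t` may follow `s`: the steps use edges of different graphings and the control states match.
For consecutive edges `e₁, e₂, e₃` this amounts to `out e₁ = inn e₃`. -/
def Next (s t : Step F G) : Prop := s.isLeft ≠ t.isLeft ∧ s.tgt = t.src

end Step

variable {F : Graphing D} {G : Graphing D'}

/-- The composition `φ_{e_n} ∘ ⋯ ∘ φ_{e_1}`. -/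
def run : List (Step F G) → X → X
  | [], x => x
  | s :: l, x => run l (s.φ x)

/-- The points which can follow the whole sequence of edges:
`φ_{e_i} (⋯ φ_{e_1} x) ∈ S_{e_{i+1}}` for all `i`. -/
def dom : List (Step F G) → Set X
  | [] => univ
  | s :: l => s.S ∩ s.φ ⁻¹' dom l

/-- The weight of a sequence of edges. -/
def weight (l : List (Step F G)) : Weight := (l.map Step.ω).prod

/-- Alternating paths. -/
def IsAltPath (l : List (Step F G)) : Prop :=
  l ≠ [] ∧ l.IsChain Step.Next ∧ vol (dom l) ≠ 0

theorem measurable_run (l : List (Step F G)) : Measurable (run l) := by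
  induction l with
  | nil => exact measurable_id
  | cons s l ih =>
    rcases s with ⟨e, d⟩ | ⟨e, d⟩
    · exact ih.comp (F.measurable_φ e)
    · exact ih.comp (G.measurable_φ e)

theorem measurableSet_dom (l : List (Step F G)) : MeasurableSet (dom l) := by
  induction l with
  | nil => exact MeasurableSet.univ
  | cons s l ih =>
    rcases s with ⟨e, d⟩ | ⟨e, d⟩
    · exact (F.measurableSet_S e).inter (F.measurable_φ e ih)
    · exact (G.measurableSet_S e).inter (G.measurable_φ e ih)

theorem dom_subset {l : List (Step F G)} (hl : l ≠ []) : dom l ⊆ F.V ∪ G.V := by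
  rcases l with _ | ⟨⟨e, d⟩ | ⟨e, d⟩, l⟩
  · exact absurd rfl hl
  · exact fun x hx => Or.inl (F.S_subset e hx.1)
  · exact fun x hx => Or.inr (G.S_subset e hx.1)

theorem run_mem {l : List (Step F G)} (hl : l ≠ []) {x : X} (hx : x ∈ dom l) :
    run l x ∈ F.V ∪ G.V := by
  induction l generalizing x with
  | nil => exact absurd rfl hl
  | cons s l ih =>
    by_cases h : l = []
    · subst h
      rcases s with ⟨e, d⟩ | ⟨e, d⟩
      · exact Or.inl (F.mapsTo e hx.1)
      · exact Or.inr (G.mapsTo e hx.1)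
    · exact ih h hx.2

/-- The execution `F ⋈ G`: the alternating paths, restricted to the points which lie outside
the common part `C` of the supports and are mapped outside of it. -/
def exec [Countable D] [Countable D'] (F : Graphing D) (G : Graphing D') :
    Graphing (D × D') where
  V := (F.V \ G.V) ∪ (G.V \ F.V)
  measurableSet_V :=
    (F.measurableSet_V.diff G.measurableSet_V).union (G.measurableSet_V.diff F.measurableSet_V)
  E := {l : List (Step F G) // IsAltPath l}
  countable_E := by
    have := F.countable_E
    have := G.countable_E
    infer_instance
  S l := dom l.1 ∩ (F.V ∩ G.V)ᶜ ∩ run l.1 ⁻¹' (F.V ∩ G.V)ᶜ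
  measurableSet_S l := by
    have hC := (F.measurableSet_V.inter G.measurableSet_V).compl
    exact ((measurableSet_dom l.1).inter hC).inter (measurable_run l.1 hC)
  S_subset l x hx := by
    have h1 := dom_subset l.2.1 hx.1.1
    have h2 := hx.1.2
    simp only [mem_compl_iff, mem_inter_iff, mem_union, mem_sdiff] at h1 h2 ⊢
    tauto
  φ l := run l.1
  measurable_φ l := measurable_run l.1
  mapsTo l x hx := by
    have h1 := run_mem l.2.1 hx.1.1
    have h2 := hx.2
    simp only [mem_preimage, mem_compl_iff, mem_inter_iff, mem_union, mem_sdiff] at h1 h2 ⊢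
    tauto
  inn l := (l.1.head l.2.1).src
  out l := (l.1.getLast l.2.1).tgt
  ω l := weight l.1

/-- The tensor product `F ⊗ G` of graphings of disjoint supports: their disjoint union, where
the edges of each of them leave the control state of the other one unchanged. -/
def tensor [Countable D] [Countable D'] (F : Graphing D) (G : Graphing D') :
    Graphing (D × D') where
  V := F.V ∪ G.V
  measurableSet_V := F.measurableSet_V.union G.measurableSet_V
  E := Step F G
  countable_E := by
    have := F.countable_E
    have := G.countable_E
    infer_instance
  S := Step.S
  measurableSet_S
    | .inl (e, _) => F.measurableSet_S e
    | .inr (e, _) => G.measurableSet_S e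
  S_subset
    | .inl (e, _) => fun _ hx => Or.inl (F.S_subset e hx)
    | .inr (e, _) => fun _ hx => Or.inr (G.S_subset e hx)
  φ := Step.φ
  measurable_φ
    | .inl (e, _) => F.measurable_φ e
    | .inr (e, _) => G.measurable_φ e
  mapsTo
    | .inl (e, _) => fun _ hx => Or.inl (F.mapsTo e hx)
    | .inr (e, _) => fun _ hx => Or.inr (G.mapsTo e hx)
  inn := Step.src
  out := Step.tgt
  ω := Step.ω

/-! ### Cycles -/

/-- The `k`-fold concatenation `π^k`. -/
def pow (l : List (Step F G)) (k : ℕ) : List (Step F G) := (List.replicate k l).flatten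

/-- Closed alternating paths: alternating paths whose first edge may follow the last one. -/
def IsClosedPath (l : List (Step F G)) : Prop :=
  IsAltPath l ∧ (l ++ l).IsChain Step.Next

/-- The path is different from all its proper cyclic permutations, i.e. not a proper power. -/
def IsPrimitive (l : List (Step F G)) : Prop :=
  ∀ k, 0 < k → k < l.length → l.rotate k ≠ l

/-- A set of representatives of circuits (classes of primitive closed alternating paths
modulo cyclic permutations). -/
def repCirc (F : Graphing D) (G : Graphing D') : Set (List (Step F G)) :=
  {l | IsClosedPath l ∧ IsPrimitive l ∧ Quotient.out (l : Cycle (Step F G)) = l}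

/-- The points which can follow the closed path indefinitely. -/
def supp (l : List (Step F G)) : Set X := {x | ∀ k : ℕ, (run l)^[k] x ∈ dom l}

/-- The measurement `⟦F, G⟧`, the sum over the circuits `π` of the integrals over `supp π` of
`m (ω(π) ^ ρ(x)) / ρ(x)`, where `ρ(x)` is the least `n ≥ 1` such that `φ_π^n x = x`.
When there is no such `n`, `ρ(x) = ∞` (and `Function.minimalPeriod` is `0`), and the integrand
is `0`. -/
def meas (F : Graphing D) (G : Graphing D') : ℝ≥0∞ :=
  ∑' l : repCirc F G, ∫⁻ x in supp l.1,
    (if Function.minimalPeriod (run l.1) x = 0 then 0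
     else (weight l.1 ^ Function.minimalPeriod (run l.1) x).param /
       (Function.minimalPeriod (run l.1) x : ℝ≥0∞)) ∂vol

/-- The points whose trajectory along the path (endpoints included) meets `R`. -/
def visits (l : List (Step F G)) (R : Set X) : Set X :=
  {x | ∃ l', l' <+: l ∧ run l' x ∈ R}

/-- An alternating cycle passing through `R`: a closed alternating path such that a
non-negligible set of points follow it, pass through `R`, and are brought back to themselves. -/
def IsCycleThrough (l : List (Step F G)) (R : Set X) : Prop :=
  IsClosedPath l ∧ vol {x | x ∈ dom l ∧ x ∈ visits l R ∧ run l x = x} ≠ 0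

/-- A closed alternating path passing through `R` which can be followed any number of times by a
non-negligible set of points passing through `R`, not necessarily coming back to themselves. -/
def IsIterableCycleThrough (l : List (Step F G)) (R : Set X) : Prop :=
  IsClosedPath l ∧ ∀ k, 1 ≤ k → vol {x | x ∈ dom (pow l k) ∧ x ∈ visits l R} ≠ 0

end Paths

/-! ### Projects, orthogonality, conducts -/

/-- Pairs `(a, ∑ αᵢ Aᵢ)` of a wager and a finite formal sum of graphings of support `V`. The wager
is allowed to be infinite here, so that execution is always defined; see `Project.IsProper`. -/
structure Project where
  V : Set X
  wager : EReal
  I : Type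
  fintype_I : Fintype I
  coeff : I → ℝ
  D : I → Type
  finite_D : ∀ i, Finite (D i)
  gr : ∀ i, Graphing (D i)
  gr_V : ∀ i, (gr i).V = V

attribute [instance] Project.fintype_I Project.finite_D

/-- The actual projects of the model: the wager is a real number, and the graphings are
realised in the microcosm `𝔞`. -/
def Project.IsProper (𝔞 : Microcosm) (p : Project) : Prop :=
  p.wager ≠ ⊤ ∧ p.wager ≠ ⊥ ∧ ∀ i, (p.gr i).RealisedIn 𝔞

/-- The pair `(a, G)`. -/
def Project.of {D : Type} [Finite D] (a : EReal) (G : Graphing D) : Project where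
  V := G.V
  wager := a
  I := Unit
  fintype_I := inferInstance
  coeff _ := 1
  D _ := D
  finite_D _ := inferInstance
  gr _ := G
  gr_V _ := rfl

/-- The measurement of projects. An infinite summand makes the sum infinite (`⊤ + ⊥ = ⊥`). -/
def Project.meas (p q : Project) : EReal :=
  p.wager * ((∑ j, q.coeff j : ℝ) : EReal) + q.wager * ((∑ i, p.coeff i : ℝ) : EReal) +
    ∑ i, ∑ j, ((p.coeff i * q.coeff j : ℝ) : EReal) * ((IGraph.meas (p.gr i) (q.gr j) : ℝ≥0∞) : EReal)

/-- The execution of projects. -/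
def Project.exec (p q : Project) : Project where
  V := (p.V \ q.V) ∪ (q.V \ p.V)
  wager := p.meas q
  I := p.I × q.I
  fintype_I := inferInstance
  coeff i := p.coeff i.1 * q.coeff i.2
  D i := p.D i.1 × q.D i.2
  finite_D _ := inferInstance
  gr i := IGraph.exec (p.gr i.1) (q.gr i.2)
  gr_V i := by simp only [IGraph.exec, p.gr_V, q.gr_V]

/-- Orthogonality: equal supports and measurement different from `0` and `∞`. -/
def Project.Orth (p q : Project) : Prop :=
  p.V = q.V ∧ p.meas q ≠ 0 ∧ p.meas q ≠ ⊤ ∧ p.meas q ≠ ⊥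

/-- The orthogonal of a set of projects. -/
def polar (𝔞 : Microcosm) (A : Set Project) : Set Project :=
  {q | q.IsProper 𝔞 ∧ ∀ p ∈ A, p.Orth q}

/-- `A ⊸ B`, for `A` and `B` of disjoint supports `VA`, `VB`. -/
def lolli (𝔞 : Microcosm) (VA VB : Set X) (A B : Set Project) : Set Project :=
  {f | f.IsProper 𝔞 ∧ f.V = VA ∪ VB ∧ ∀ a ∈ A, f.exec a ∈ B}

/-- The set of all projects of support `V`. -/
def allProjects (𝔞 : Microcosm) (V : Set X) : Set Project := {p | p.IsProper 𝔞 ∧ p.V = V}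

/-! ### Promotion -/

/-- Translation by `c` on `[0,1]`, modulo `1`. -/
def rot (c : ℝ) (x : I01) : I01 :=
  ⟨Int.fract ((x : ℝ) + c), Int.fract_nonneg _, (Int.fract_lt_one _).le⟩

/-- The sequence `a · s`. -/
def cons (a : I01) (s : ℕ → I01) : ℕ → I01
  | 0 => a
  | k + 1 => s k

/-- The sequence without its first element. -/
def tail (s : ℕ → I01) : ℕ → I01 := fun k => s (k + 1)

theorem measurable_rot (c : ℝ) : Measurable (rot c) := by
  unfold rot
  exact Measurable.subtype_mk (by fun_prop)

theorem measurable_tail : Measurable tail :=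
  measurable_pi_lambda _ fun k => measurable_pi_apply (k + 1)

theorem measurable_cons : Measurable (fun p : I01 × (ℕ → I01) => cons p.1 p.2) := by
  refine measurable_pi_lambda _ fun k => ?_
  cases k with
  | zero => exact measurable_fst
  | succ k => exact (measurable_pi_apply k).comp measurable_snd

section Promotion

variable (P : I01 × I01 ≃ᵐ I01)

/-- `{(a, [x, y] · s) | (a, s) ∈ A, d ≤ N x ≤ d + 1}`, where `[x, y] = P (x, y)`. -/
def pushSet (N d : ℕ) (A : Set X) : Set X :=
  {p | (p.1, tail p.2) ∈ A ∧ (d : ℝ) ≤ N * ((P.symm (p.2 0)).1 : ℝ) ∧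
    N * ((P.symm (p.2 0)).1 : ℝ) ≤ d + 1}

/-- `(a, [x, y] · s) ↦ (a', [x + (d' - d) / N, y] · s')` where `(a', s') = f (a, s)`, the
sum being taken modulo `1`. -/
def pushMap (N d d' : ℕ) (f : X → X) : X → X := fun p =>
  ((f (p.1, tail p.2)).1,
    cons (P (rot (((d' : ℝ) - d) / N) (P.symm (p.2 0)).1, (P.symm (p.2 0)).2))
      (f (p.1, tail p.2)).2)

theorem measurable_dropFirst : Measurable (fun p : X => ((p.1, tail p.2) : X)) :=
  measurable_fst.prodMk (measurable_tail.comp measurable_snd)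

theorem measurable_unpair : Measurable (fun p : X => P.symm (p.2 0)) :=
  P.symm.measurable.comp ((measurable_pi_apply 0).comp measurable_snd)

theorem measurableSet_pushSet (N d : ℕ) {A : Set X} (hA : MeasurableSet A) :
    MeasurableSet (pushSet P N d A) := by
  have h : Measurable (fun p : X => (N : ℝ) * ((P.symm (p.2 0)).1 : ℝ)) :=
    (measurable_subtype_coe.comp (measurable_fst.comp (measurable_unpair P))).const_mul _
  exact (measurable_dropFirst hA).inter
    ((measurableSet_le measurable_const h).inter (measurableSet_le h measurable_const))

theorem measurable_pushMap (N d d' : ℕ) {f : X → X} (hf : Measurable f) :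
    Measurable (pushMap P N d d' f) := by
  have h1 : Measurable (fun p : X => f (p.1, tail p.2)) := hf.comp measurable_dropFirst
  have h2 := measurable_unpair P
  have h3 : Measurable (fun p : X =>
      P (rot (((d' : ℝ) - d) / N) (P.symm (p.2 0)).1, (P.symm (p.2 0)).2)) :=
    P.measurable.comp
      (((measurable_rot _).comp (measurable_fst.comp h2)).prodMk (measurable_snd.comp h2))
  exact (measurable_fst.comp h1).prodMk
    (measurable_cons.comp (h3.prodMk (measurable_snd.comp h1)))

/-- The promotion `!G` of a graphing whose dialect has `N` elements. -/
def promote {N : ℕ} (G : Graphing (Fin N)) : Graphing (Fin 1) where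
  V := {p | (p.1, tail p.2) ∈ G.V}
  measurableSet_V := measurable_dropFirst G.measurableSet_V
  E := G.E
  countable_E := G.countable_E
  S e := pushSet P N (G.inn e) (G.S e)
  measurableSet_S e := measurableSet_pushSet P N _ (G.measurableSet_S e)
  S_subset e _ hp := G.S_subset e hp.1
  φ e := pushMap P N (G.inn e) (G.out e) (G.φ e)
  measurable_φ e := measurable_pushMap P N _ _ (G.measurable_φ e)
  mapsTo e _ hp := G.mapsTo e hp.1
  inn _ := 0
  out _ := 0
  ω := G.ω

end Promotion

/-! ### Words -/

/-- Directions. -/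
inductive Dir
  | inn
  | out

/-- The vertices: `(s, d)` with `s ∈ {⋆, 0, 1}` (`⋆` is `none`) and `d` a direction, and the
two vertices `a` (accept) and `r` (reject). -/
inductive Vertex
  | sym (s : Option Bool) (d : Dir)
  | acc
  | rej

/-- The set of the vertices `(s, d)`. -/
def extVertices : Set Vertex := {v | ∃ s d, v = Vertex.sym s d}

/-- The subset `{Ψ v} × [0,1]^ℕ`, union over `v ∈ T`. -/
def region (Ψ : Vertex → ℤ) (T : Set Vertex) : Set X := {p | p.1 ∈ Ψ '' T}

theorem measurableSet_region (Ψ : Vertex → ℤ) (T : Set Vertex) : MeasurableSet (region Ψ T) :=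
  measurable_fst (MeasurableSet.of_discrete (s := Ψ '' T))

/-- The support of the word representations. -/
def wordSupport (Ψ : Vertex → ℤ) : Set X := region Ψ extVertices

/-- The support of the results, associated with `{a, r}`. -/
def resultSupport (Ψ : Vertex → ℤ) : Set X := region Ψ {Vertex.acc, Vertex.rej}

/-- The part of the space associated with `r`. -/
def rejRegion (Ψ : Vertex → ℤ) : Set X := region Ψ {Vertex.rej}

/-- The letters `⋆ a₁ … a_k`. -/
def letter (w : List Bool) : Fin (w.length + 1) → Option Bool :=
  Fin.cons none (fun i => some (w.get i))

/-- Source vertices of the edges: `(r, i)` is `(true, i)` and `(l, i)` is `(false, i)`. -/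
def wordSrc (w : List Bool) : Bool × Fin (w.length + 1) → Vertex
  | (true, i) => .sym (letter w i) .out
  | (false, i) => .sym (letter w i) .inn

/-- The next state (modulo `k + 1`). -/
def wordNext (w : List Bool) : Bool × Fin (w.length + 1) → Fin (w.length + 1)
  | (true, i) => i + 1
  | (false, i) => i - 1

/-- Target vertices of the edges. -/
def wordTgt (w : List Bool) (e : Bool × Fin (w.length + 1)) : Vertex :=
  .sym (letter w (wordNext w e)) (if e.1 then .inn else .out)

theorem wordSrc_mem (w : List Bool) (e : Bool × Fin (w.length + 1)) :
    wordSrc w e ∈ extVertices := by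
  rcases e with ⟨_ | _, i⟩
  · exact ⟨_, _, rfl⟩
  · exact ⟨_, _, rfl⟩

/-- The word graphing of `⋆ a₁ … a_k`, with dialect renamed along `ι : [k] → [n]`. -/
def wordGraphing (Ψ : Vertex → ℤ) (w : List Bool) {n : ℕ}
    (ι : Fin (w.length + 1) ↪ Fin (n + 1)) : Graphing (Fin (n + 1)) where
  V := wordSupport Ψ
  measurableSet_V := measurableSet_region _ _
  E := Bool × Fin (w.length + 1)
  countable_E := inferInstance
  S e := region Ψ {wordSrc w e}
  measurableSet_S _ := measurableSet_region _ _
  S_subset e _ hp := image_mono (singleton_subset_iff.2 (wordSrc_mem w e)) hp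
  φ e := transl (Ψ (wordTgt w e) - Ψ (wordSrc w e))
  measurable_φ e := (measurePreserving_transl _).measurable
  mapsTo e p hp := by
    obtain ⟨v, hv, hp⟩ := hp
    rw [mem_singleton_iff.1 hv] at hp
    refine ⟨wordTgt w e, ⟨_, _, rfl⟩, ?_⟩
    simp only [transl, ← hp]
    ring
  inn e := ι e.2
  out e := ι (wordNext w e)
  ω _ := 1

/-- The word representation `!W`, for `W` the word graphing renamed along `ι`. -/
def wordRep (P : I01 × I01 ≃ᵐ I01) (Ψ : Vertex → ℤ) (w : List Bool) {n : ℕ}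
    (ι : Fin (w.length + 1) ↪ Fin (n + 1)) : Graphing (Fin 1) :=
  promote P (wordGraphing Ψ w ι)

/-- The projects `(0, !W)`, for all the representations `!W` of all words. -/
def wordProjects (P : I01 × I01 ≃ᵐ I01) (Ψ : Vertex → ℤ) : Set Project :=
  {p | ∃ (w : List Bool) (n : ℕ) (ι : Fin (w.length + 1) ↪ Fin (n + 1)),
    p = Project.of 0 (wordRep P Ψ w ι)}

/-- The conduct `!List`: the bi-orthogonal of the word representations. -/
def ocList (P : I01 × I01 ≃ᵐ I01) (Ψ : Vertex → ℤ) : Set Project :=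
  polar ambient (polar ambient (wordProjects P Ψ))

/-- The type `!List ⊸ NBool` of predicates. -/
def predType (P : I01 × I01 ≃ᵐ I01) (Ψ : Vertex → ℤ) : Set Project :=
  lolli ambient (wordSupport Ψ) (resultSupport Ψ) (ocList P Ψ)
    (allProjects ambient (resultSupport Ψ))

/-- Nondeterministic predicate `𝔪`-machines. -/
structure IsMachine (P : I01 × I01 ≃ᵐ I01) (Ψ : Vertex → ℤ) (𝔪 : Microcosm)
    {D : Type} [Finite D] (G : Graphing D) : Prop where
  finite : G.IsFinite
  realisedIn : G.RealisedIn 𝔪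
  weight_one : ∀ e, G.ω e = 1
  mem_predType : Project.of 0 G ∈ predType P Ψ

/-! ### The test -/

/-- The graphing `Id_[r]` of support `[a] ∪ [r]`, with a single edge: the identity on `[r]`,
of weight `1·𝟏`. -/
def idRej (Ψ : Vertex → ℤ) : Graphing (Fin 1) where
  V := resultSupport Ψ
  measurableSet_V := measurableSet_region _ _
  E := Unit
  countable_E := inferInstance
  S _ := rejRegion Ψ
  measurableSet_S _ := measurableSet_region _ _
  S_subset _ _ hp := image_mono (by simp) hp
  φ _ := id
  measurable_φ _ := measurable_id
  mapsTo _ _ hp := image_mono (by simp) hp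
  inn _ := 0
  out _ := 0
  ω _ := ⟨1, true⟩

/-- The test `T⁻`: the projects `(ζ, Id_[r])` for the real numbers `ζ ≠ 0`. -/
def testNeg (Ψ : Vertex → ℤ) : Set Project :=
  {p | ∃ ζ : ℝ, ζ ≠ 0 ∧ p = Project.of (ζ : EReal) (idRej Ψ)}

/-- A project is orthogonal to a test when it is orthogonal to all its elements. -/
def Project.OrthTest (p : Project) (T : Set Project) : Prop := ∀ t ∈ T, p.Orth t

end IGraph

end

/-!
The weights of `G` and `!W` are unmarked, so `⟦G, !W⟧ = 0` and the measurement of `G ⋈ !W` against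
`(ζ, Id_[r])` is `ζ + ⟦G ⋈ !W, Id_[r]⟧`. As `ζ` ranges over the non-zero reals, this is never zero
nor infinite if and only if `⟦G ⋈ !W, Id_[r]⟧ = 0` (`orthTest_testNeg_iff`).

Every circuit between `G ⋈ !W` and `Id_[r]` uses the marked edge, so it has weight `1·𝟏`, and its
contribution is the integral of `1 / ρ` over its periodic points. The measurement is therefore
non-zero if and only if some closed sequence of steps has a non-negligible set of fixed points
(`meas_ne_zero_iff`): a closed sequence is a power of a primitive one (`IsLoop.exists_primitive`),
and changing its starting point preserves non-negligible sets of fixed points because preimages of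
negligible sets under the realisers are negligible.

Execution is associative on the level of paths. A closed path between `G ⋈ !W` and `Id_[r]` unfolds
to one between `G` and `!W ⊗ Id_[r]`; conversely, a closed path of the latter kind which uses
`Id_[r]` is cut at these uses, and the parts in between start and end outside the support of `!W`,
so that they are edges of `G ⋈ !W` (`exists_loop_exec_iff`). A periodic trajectory of the latter
kind uses `Id_[r]` exactly when it meets `[r]`, because `!W` does not touch `[r]`
(`exists_isCycleThrough_iff`). This is the first equivalence.

When the realisers of `G` are in `𝔪_∞`, the realiser of a path acts, up to a negligible set, by an
integer translation, a permutation of finitely many coordinates, and rotations of the coordinates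
by multiples of `1 / N`, the latter coming from `!W`. If the path can be followed arbitrarily many
times, the translation is trivial since the supports are bounded, and what is left has finite order
(`IsTwisted.exists_iterate_eqOn_id`). So a power of the path brings almost every point back to
itself, and the two notions of cycles agree.
-/

namespace IGraph

/-! ### Running along paths -/

section Paths

variable {D D' : Type} {F : Graphing D} {G : Graphing D'}

/-- The points which follow the path `l` once and are brought back to themselves. -/
def fixSet (l : List (Step F G)) : Set X := {x | x ∈ dom l ∧ run l x = x}

/-- All the realisers are quasi-measure-preserving: preimages of negligible sets are negligible. -/
def Graphing.IsQMP (F : Graphing D) : Prop :=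
  ∀ e, Measure.QuasiMeasurePreserving (F.φ e) vol vol

theorem run_append (a b : List (Step F G)) (x : X) : run (a ++ b) x = run b (run a x) := by
  induction a generalizing x with
  | nil => rfl
  | cons s a ih => exact ih _

theorem mem_dom_append {a b : List (Step F G)} {x : X} :
    x ∈ dom (a ++ b) ↔ x ∈ dom a ∧ run a x ∈ dom b := by
  induction a generalizing x with
  | nil => simp [dom, run]
  | cons s a ih =>
    have h : s.φ x ∈ dom (a ++ b) ↔ s.φ x ∈ dom a ∧ run a (s.φ x) ∈ dom b := ih
    simp only [List.cons_append, dom, mem_inter_iff, mem_preimage, run, h, and_assoc]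

theorem pow_zero_path (l : List (Step F G)) : pow l 0 = [] := rfl

theorem pow_succ_path (l : List (Step F G)) (k : ℕ) : pow l (k + 1) = l ++ pow l k := by
  simp [pow, List.replicate_succ]

theorem pow_one_path (l : List (Step F G)) : pow l 1 = l := by
  simp [pow]

theorem pow_add_path (l : List (Step F G)) (j k : ℕ) : pow l (j + k) = pow l j ++ pow l k := by
  simp only [pow, List.replicate_add, List.flatten_append]

theorem pow_mul_path (l : List (Step F G)) (j k : ℕ) : pow (pow l j) k = pow l (j * k) := by
  induction k with
  | zero => rfl
  | succ k ih => rw [pow_succ_path, ih, Nat.mul_succ, Nat.add_comm, pow_add_path]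

theorem pow_append_comm (a b : List (Step F G)) (k : ℕ) :
    pow (a ++ b) k ++ a = a ++ pow (b ++ a) k := by
  induction k with
  | zero => simp [pow_zero_path]
  | succ k ih => simp only [pow_succ_path, List.append_assoc, ih]

theorem run_pow (l : List (Step F G)) (k : ℕ) : run (pow l k) = (run l)^[k] := by
  induction k with
  | zero => rfl
  | succ k ih =>
    ext1 x
    rw [pow_succ_path, run_append, ih, Function.iterate_succ_apply]

theorem mem_dom_pow {l : List (Step F G)} {k : ℕ} {x : X} :
    x ∈ dom (pow l k) ↔ ∀ j < k, (run l)^[j] x ∈ dom l := by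
  induction k with
  | zero => simp [pow_zero_path, dom]
  | succ k ih =>
    rw [pow_add_path, pow_one_path, mem_dom_append, ih, run_pow]
    simp only [Nat.lt_succ_iff_lt_or_eq, or_imp, forall_and, forall_eq]

theorem supp_eq_iInter (l : List (Step F G)) : supp l = ⋂ k : ℕ, (run l)^[k] ⁻¹' dom l := by
  ext x
  simp [supp]

theorem measurableSet_supp (l : List (Step F G)) : MeasurableSet (supp l) := by
  rw [supp_eq_iInter]
  exact MeasurableSet.iInter fun k => ((measurable_run l).iterate k) (measurableSet_dom l)

theorem measurableSet_fixSet (l : List (Step F G)) : MeasurableSet (fixSet l) :=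
  (measurableSet_dom l).inter (measurableSet_eq_fun (measurable_run l) measurable_id)

/-- A point which comes back to itself after `n` turns along `l` can follow `l` forever. -/
theorem fixSet_pow_subset_supp {l : List (Step F G)} {n : ℕ} (hn : 0 < n) :
    fixSet (pow l n) ⊆ supp l := by
  intro x hx k
  have hper : Function.IsPeriodicPt (run l) n x := by
    have h := hx.2
    rwa [run_pow] at h
  rw [← hper.iterate_mod_apply k]
  exact mem_dom_pow.1 hx.1 _ (Nat.mod_lt k hn)

/-- Moving the starting point of a cycle along the initial segment `a`. -/
theorem fixSet_append_subset (a b : List (Step F G)) :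
    fixSet (a ++ b) ⊆ run a ⁻¹' fixSet (b ++ a) := by
  intro x hx
  have h1 := mem_dom_append.1 hx.1
  have h2 : run b (run a x) = x := by rw [← run_append]; exact hx.2
  refine ⟨mem_dom_append.2 ⟨h1.2, ?_⟩, ?_⟩
  · rw [h2]; exact h1.1
  · rw [run_append, h2]

theorem Step.quasiMeasurePreserving (hF : F.IsQMP) (hG : G.IsQMP) :
    ∀ s : Step F G, Measure.QuasiMeasurePreserving s.φ vol vol
  | .inl (e, _) => hF e
  | .inr (e, _) => hG e

theorem quasiMeasurePreserving_run (hF : F.IsQMP) (hG : G.IsQMP) (l : List (Step F G)) :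
    Measure.QuasiMeasurePreserving (run l) vol vol := by
  induction l with
  | nil => exact Measure.QuasiMeasurePreserving.id vol
  | cons s l ih => exact ih.comp (s.quasiMeasurePreserving hF hG)

theorem vol_ne_zero_of_subset_preimage_run (hF : F.IsQMP) (hG : G.IsQMP)
    (l : List (Step F G)) {A B : Set X} (hAB : A ⊆ run l ⁻¹' B) (hA : vol A ≠ 0) :
    vol B ≠ 0 :=
  fun hB => hA (measure_mono_null hAB
    ((quasiMeasurePreserving_run hF hG l).preimage_null hB))

theorem vol_fixSet_append_comm (hF : F.IsQMP) (hG : G.IsQMP) {a b : List (Step F G)}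
    (h : vol (fixSet (a ++ b)) ≠ 0) : vol (fixSet (b ++ a)) ≠ 0 :=
  vol_ne_zero_of_subset_preimage_run hF hG a (fixSet_append_subset a b) h

theorem vol_fixSet_pow_append_comm (hF : F.IsQMP) (hG : G.IsQMP) {a b : List (Step F G)} {n : ℕ}
    (h : vol (fixSet (pow (a ++ b) n)) ≠ 0) : vol (fixSet (pow (b ++ a) n)) ≠ 0 := by
  cases n with
  | zero => exact h
  | succ k =>
    rw [pow_succ_path, List.append_assoc] at h
    have h' := vol_fixSet_append_comm hF hG h
    rwa [List.append_assoc, pow_append_comm, ← List.append_assoc, ← pow_succ_path] at h'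

theorem dom_ne_zero_of_fixSet {l : List (Step F G)} (h : vol (fixSet l) ≠ 0) :
    vol (dom l) ≠ 0 :=
  fun h0 => h (measure_mono_null (fun _ hx => hx.1) h0)

/-! ### Closed paths -/

/-- `l` is a non-empty sequence of steps, in which steps may follow each other also cyclically. -/
def IsLoop (l : List (Step F G)) : Prop := l ≠ [] ∧ (l ++ l).IsChain Step.Next

theorem isClosedPath_iff {l : List (Step F G)} :
    IsClosedPath l ↔ IsLoop l ∧ vol (dom l) ≠ 0 :=
  ⟨fun h => ⟨⟨h.1.1, h.2⟩, h.1.2.2⟩,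
    fun h => ⟨⟨h.1.1, h.1.2.left_of_append, h.2⟩, h.1.2⟩⟩

theorem IsLoop.isChain_pow {l : List (Step F G)} (h : IsLoop l) (k : ℕ) :
    (pow l k).IsChain Step.Next := by
  induction k with
  | zero => exact List.isChain_nil
  | succ k ih =>
    cases k with
    | zero => rw [pow_one_path]; exact h.2.left_of_append
    | succ k =>
      rw [pow_succ_path, pow_succ_path, ← List.append_assoc]
      rw [pow_succ_path] at ih
      exact h.2.append_overlap ih h.1

theorem IsLoop.pow {l : List (Step F G)} (h : IsLoop l) {k : ℕ} (hk : 0 < k) :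
    IsLoop (pow l k) := by
  obtain ⟨k, rfl⟩ := Nat.exists_eq_succ_of_ne_zero hk.ne'
  refine ⟨?_, ?_⟩
  · rw [pow_succ_path]
    simp [h.1]
  · rw [← pow_add_path]
    exact h.isChain_pow _

theorem IsLoop.of_pow {l : List (Step F G)} {k : ℕ} (hk : 2 ≤ k) (h : IsLoop (IGraph.pow l k)) :
    IsLoop l := by
  obtain ⟨k, rfl⟩ := Nat.exists_eq_add_of_le hk
  refine ⟨?_, ?_⟩
  · rintro rfl
    exact h.1 (by simp [IGraph.pow])
  · have h' := h.2.left_of_append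
    rw [pow_add_path, pow_succ_path, pow_one_path] at h'
    exact h'.left_of_append

theorem IsLoop.append_comm {a b : List (Step F G)} (h : IsLoop (a ++ b)) : IsLoop (b ++ a) := by
  refine ⟨fun h0 => h.1 ?_, ?_⟩
  · simp only [List.append_eq_nil_iff] at h0 ⊢
    exact h0.symm
  · refine (h.isChain_pow 3).infix ⟨a, b, ?_⟩
    simp [pow_succ_path, pow_zero_path]

/-- Edges of the two graphings alternate, so both occur in a loop. -/
theorem IsLoop.exists_isRight {l : List (Step F G)} (h : IsLoop l) : ∃ s ∈ l, s.isRight := by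
  obtain ⟨hne, hch⟩ := h
  rcases l with _ | ⟨s, _ | ⟨t, l⟩⟩
  · exact absurd rfl hne
  · simp [Step.Next] at hch
  · have := (List.isChain_cons_cons.1 hch).1.1
    rcases s with s | s
    · rcases t with t | t
      · simp at this
      · exact ⟨.inr t, by simp, rfl⟩
    · exact ⟨.inr s, by simp, rfl⟩

/-! ### Primitive roots -/

/-- Two commuting words are powers of a common word. -/
theorem exists_pow_of_append_comm (a b : List (Step F G)) (h : a ++ b = b ++ a) :
    ∃ c i j, a = pow c i ∧ b = pow c j := by
  induction hn : a.length + b.length using Nat.strong_induction_on generalizing a b with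
  | _ n ih =>
    wlog hab : a.length ≤ b.length generalizing a b
    · obtain ⟨c, i, j, h1, h2⟩ := this b a h.symm (by omega) (by omega)
      exact ⟨c, j, i, h2, h1⟩
    by_cases ha : a = []
    · exact ⟨b, 0, 1, by simp [pow, ha], by simp [pow]⟩
    obtain ⟨b', rfl⟩ : a <+: b :=
      List.prefix_of_prefix_length_le (List.prefix_append a b) (h ▸ List.prefix_append b a) hab
    have hpos := List.length_pos_iff.2 ha
    simp only [List.length_append] at hn
    rw [List.append_assoc, List.append_cancel_left_eq] at h
    obtain ⟨c, i, j, h1, h2⟩ := ih _ (by omega) a b' h rfl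
    exact ⟨c, i, i + j, h1, by rw [pow_add_path, ← h1, ← h2]⟩

/-- Every loop is a power of a primitive loop. -/
theorem IsLoop.exists_primitive {l : List (Step F G)} (h : IsLoop l) :
    ∃ c k, 0 < k ∧ IsLoop c ∧ IsPrimitive c ∧ l = IGraph.pow c k := by
  induction hn : l.length using Nat.strong_induction_on generalizing l with
  | _ n ih =>
    by_cases hp : IsPrimitive l
    · exact ⟨l, 1, one_pos, h, hp, (pow_one_path l).symm⟩
    simp only [IsPrimitive, not_forall, not_not] at hp
    obtain ⟨k, hk0, hk, hrot⟩ := hp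
    rw [List.rotate_eq_drop_append_take hk.le] at hrot
    obtain ⟨c, i, j, h1, h2⟩ := exists_pow_of_append_comm (l.take k) (l.drop k)
      (by rw [List.take_append_drop, hrot])
    have hl : l = IGraph.pow c (i + j) := by
      rw [pow_add_path, ← h1, ← h2, List.take_append_drop]
    have hi : i ≠ 0 := by
      rintro rfl
      have := congrArg List.length h1
      rw [List.length_take, pow_zero_path, List.length_nil] at this
      omega
    have hj : j ≠ 0 := by
      rintro rfl
      have := congrArg List.length h2
      rw [List.length_drop, pow_zero_path, List.length_nil] at this
      omega
    have hc : IsLoop c := IsLoop.of_pow (k := i + j) (by omega) (hl ▸ h)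
    have hlen : c.length < n := by
      have h3 : l.length = (i + j) * c.length := by
        rw [hl]; simp [IGraph.pow]
      have h4 := List.length_pos_iff.2 hc.1
      have : 2 ≤ i + j := by omega
      nlinarith
    obtain ⟨d, m, hm, hd, hdp, hdc⟩ := ih _ hlen hc rfl
    exact ⟨d, m * (i + j), Nat.mul_pos hm (by omega), hd, hdp, by rw [hl, hdc, pow_mul_path]⟩

theorem IsPrimitive.append_comm {a b : List (Step F G)} (h : IsPrimitive (a ++ b)) :
    IsPrimitive (b ++ a) := by
  intro k hk0 hk hrot
  refine h k hk0 (by simpa [Nat.add_comm] using hk) ?_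
  have h1 : a ++ b = (b ++ a).rotate b.length := by simp
  rw [h1, List.rotate_rotate, Nat.add_comm, ← List.rotate_rotate, hrot]

/-- Loops with a non-negligible set of fixed points yield circuits with a non-negligible set of
periodic points: pass to the primitive root, then to the chosen representative. -/
theorem exists_repCirc_of_loop (hF : F.IsQMP) (hG : G.IsQMP) {l : List (Step F G)}
    (hl : IsLoop l) (hv : vol (fixSet l) ≠ 0) :
    ∃ c ∈ repCirc F G, ∃ k, 0 < k ∧ vol (fixSet (pow c k)) ≠ 0 := by
  obtain ⟨c, k, hk, hc, hcp, rfl⟩ := hl.exists_primitive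
  obtain ⟨d, hd⟩ : ∃ d, Quotient.out (c : Cycle (Step F G)) = d := ⟨_, rfl⟩
  have hdc : (d : Cycle (Step F G)) = c := by rw [← hd]; exact Quotient.out_eq _
  obtain ⟨m, hm⟩ : c ~r d := (Cycle.coe_eq_coe.1 hdc).symm
  obtain ⟨a, b, rfl, rfl⟩ : ∃ a b, c = a ++ b ∧ d = b ++ a := by
    refine ⟨c.take (m % c.length), c.drop (m % c.length), (List.take_append_drop _ _).symm, ?_⟩
    rw [← hm, List.rotate_eq_drop_append_take_mod]
  have hv' := vol_fixSet_pow_append_comm hF hG hv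
  refine ⟨b ++ a, ⟨isClosedPath_iff.2 ⟨hc.append_comm, ?_⟩, hcp.append_comm, ?_⟩, k, hk, hv'⟩
  · refine fun h0 => hv' (measure_mono_null (fun x hx => ?_) h0)
    exact mem_dom_pow.1 hx.1 0 hk
  · rw [hdc, hd]

end Paths

/-! ### Measurement -/

section Measurement

variable {D D' : Type} {F : Graphing D} {G : Graphing D'}

theorem weight_cons (s : Step F G) (l : List (Step F G)) : weight (s :: l) = s.ω * weight l := by
  simp [weight]

theorem weight_eq_one (hF : ∀ e, F.ω e = 1) (hG : ∀ e, G.ω e = 1) (l : List (Step F G)) :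
    weight l = 1 := by
  induction l with
  | nil => rfl
  | cons s l ih =>
    rw [weight_cons, ih, mul_one]
    rcases s with ⟨e, d⟩ | ⟨e, d⟩
    · exact hF e
    · exact hG e

/-- The weight `1·𝟏`. -/
def Weight.marked : Weight := ⟨1, true⟩

theorem Weight.marked_mul_marked : Weight.marked * Weight.marked = Weight.marked :=
  Weight.ext (mul_one 1) rfl

theorem Weight.param_one : (1 : Weight).param = 0 := rfl

theorem Weight.param_marked_pow {n : ℕ} (hn : n ≠ 0) : (Weight.marked ^ n).param = 1 := by
  obtain ⟨n, rfl⟩ := Nat.exists_eq_succ_of_ne_zero hn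
  have h : Weight.marked ^ (n + 1) = Weight.marked := by
    induction n with
    | zero => exact pow_one _
    | succ n ih => rw [pow_succ, ih n.succ_ne_zero, Weight.marked_mul_marked]
  rw [Nat.succ_eq_add_one, h]
  simp [Weight.param, Weight.marked]

theorem weight_eq_marked (hF : ∀ e, F.ω e = 1) (hG : ∀ e, G.ω e = Weight.marked)
    {l : List (Step F G)} (hl : ∃ s ∈ l, s.isRight) : weight l = Weight.marked := by
  have key : ∀ l : List (Step F G), weight l = Weight.marked ∨
      (weight l = 1 ∧ ∀ s ∈ l, ¬ s.isRight) := by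
    intro l
    induction l with
    | nil => exact Or.inr ⟨rfl, by simp⟩
    | cons s l ih =>
      rw [weight_cons]
      rcases s with ⟨e, d⟩ | ⟨e, d⟩
      · simpa [Step.ω, hF e] using ih
      · left
        rcases ih with ih | ih
        · simp only [Step.ω, hG e, ih, Weight.marked_mul_marked]
        · simp only [Step.ω, hG e, ih.1, mul_one]
  obtain ⟨s, hs, hs'⟩ := hl
  exact (key l).resolve_right fun h => h.2 s hs hs'

theorem meas_eq_zero_of_weight_eq_one (hF : ∀ e, F.ω e = 1) (hG : ∀ e, G.ω e = 1) :
    meas F G = 0 := by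
  simp [meas, weight_eq_one hF hG, Weight.param_one]

/-- A circuit of weight `1·𝟏` contributes to the measurement if and only if it has a
non-negligible set of periodic points. -/
theorem lintegral_circuit_ne_zero_iff {l : List (Step F G)} (hw : weight l = Weight.marked) :
    (∫⁻ x in supp l, (if Function.minimalPeriod (run l) x = 0 then 0
      else (weight l ^ Function.minimalPeriod (run l) x).param /
        (Function.minimalPeriod (run l) x : ℝ≥0∞)) ∂vol) ≠ 0 ↔
      ∃ n, 0 < n ∧ vol (fixSet (pow l n)) ≠ 0 := by
  constructor
  · intro h
    by_contra! hc
    refine h (lintegral_eq_zero_of_ae_eq_zero ?_)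
    have hae : ∀ᵐ x ∂vol, ∀ n, 0 < n → x ∉ fixSet (pow l n) := by
      rw [ae_all_iff]
      intro n
      by_cases hn : 0 < n
      · filter_upwards [measure_eq_zero_iff_ae_notMem.1 (hc n hn)] with x hx _ using hx
      · exact Filter.Eventually.of_forall fun x h => absurd h hn
    rw [Filter.EventuallyEq, ae_restrict_iff' (measurableSet_supp l)]
    filter_upwards [hae] with x hx hxs
    have h0 : Function.minimalPeriod (run l) x = 0 := by
      by_contra h0
      refine hx _ (Nat.pos_of_ne_zero h0) ⟨mem_dom_pow.2 fun j _ => hxs j, ?_⟩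
      rw [run_pow]
      exact Function.iterate_minimalPeriod
    simp [h0]
  · rintro ⟨n, hn, hv⟩ h0
    refine hv ?_
    -- A point fixed by the `n`-th iterate has period at most `n`: the integrand is at least `1/n`.
    have hle : ∫⁻ _ in fixSet (pow l n), (n : ℝ≥0∞)⁻¹ ∂vol ≤ 0 := by
      rw [← h0]
      refine (setLIntegral_mono' (measurableSet_fixSet _) fun x hx => ?_).trans
        (lintegral_mono_set (fixSet_pow_subset_supp hn))
      have hper : Function.IsPeriodicPt (run l) n x := by
        have h := hx.2
        rwa [run_pow] at h
      have hp := (hper.minimalPeriod_pos hn).ne'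
      rw [if_neg hp, hw, Weight.param_marked_pow hp, one_div]
      exact ENNReal.inv_le_inv.2 (Nat.cast_le.2 (hper.minimalPeriod_le hn))
    rw [setLIntegral_const, nonpos_iff_eq_zero, mul_eq_zero] at hle
    exact hle.resolve_left (ENNReal.inv_ne_zero.2 (ENNReal.natCast_ne_top n))

theorem meas_ne_zero_iff (hF : F.IsQMP) (hG : G.IsQMP) (hFw : ∀ e, F.ω e = 1)
    (hGw : ∀ e, G.ω e = Weight.marked) :
    meas F G ≠ 0 ↔ ∃ l : List (Step F G), IsLoop l ∧ vol (fixSet l) ≠ 0 := by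
  have hrep : ∀ l ∈ repCirc F G, IsLoop l := fun l hl => (isClosedPath_iff.1 hl.1).1
  rw [meas, Ne, ENNReal.tsum_eq_zero, not_forall]
  constructor
  · rintro ⟨⟨l, hl⟩, h⟩
    obtain ⟨n, hn, hv⟩ := (lintegral_circuit_ne_zero_iff
      (weight_eq_marked hFw hGw (hrep l hl).exists_isRight)).1 h
    exact ⟨pow l n, (hrep l hl).pow hn, hv⟩
  · rintro ⟨l, hl, hv⟩
    obtain ⟨c, hc, n, hn, hv'⟩ := exists_repCirc_of_loop hF hG hl hv
    exact ⟨⟨c, hc⟩, (lintegral_circuit_ne_zero_iff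
      (weight_eq_marked hFw hGw (hrep c hc).exists_isRight)).2 ⟨n, hn, hv'⟩⟩

theorem isQMP_exec [Countable D] [Countable D'] (hF : F.IsQMP) (hG : G.IsQMP) :
    (exec F G).IsQMP :=
  fun l => quasiMeasurePreserving_run hF hG l.1

end Measurement

/-! ### Orthogonality to the test -/

/-- The wagers of `T⁻` cancel any non-zero finite measurement, and no infinite measurement is
allowed, so orthogonality to the whole test means that the measurement vanishes. -/
theorem orthTest_testNeg_iff {D D' : Type} [Finite D] [Finite D'] (Ψ : Vertex → ℤ)
    (G : Graphing D) (W : Graphing D') (hG : ∀ e, G.ω e = 1) (hW : ∀ e, W.ω e = 1)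
    (hV : (G.V \ W.V) ∪ (W.V \ G.V) = resultSupport Ψ) :
    ((Project.of 0 G).exec (Project.of 0 W)).OrthTest (testNeg Ψ) ↔
      meas (exec G W) (idRej Ψ) = 0 := by
  have hwager : (Project.of 0 G).meas (Project.of 0 W) = 0 := by
    simp [Project.meas, Project.of, meas_eq_zero_of_weight_eq_one hG hW]
  have hmeas : ∀ ζ : ℝ, ((Project.of 0 G).exec (Project.of 0 W)).meas
      (Project.of (ζ : EReal) (idRej Ψ)) =
        (ζ : EReal) + ((meas (exec G W) (idRej Ψ) : ℝ≥0∞) : EReal) := by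
    intro ζ
    have h : ((Project.of 0 G).exec (Project.of 0 W)).wager = 0 := hwager
    have hsum : ((Project.of 0 G).exec (Project.of 0 W)).meas (Project.of (ζ : EReal) (idRej Ψ)) =
        0 * ((∑ _ : Unit, (1 : ℝ) : ℝ) : EReal) +
          (ζ : EReal) * ((∑ _ : Unit × Unit, (1 * 1 : ℝ) : ℝ) : EReal) +
          ∑ _ : Unit × Unit, ∑ _ : Unit, ((1 * 1 * 1 : ℝ) : EReal) *
            ((meas (exec G W) (idRej Ψ) : ℝ≥0∞) : EReal) := by
      rw [Project.meas, h]
      rfl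
    rw [hsum]
    simp
  constructor
  · intro h
    by_contra h0
    by_cases htop : meas (exec G W) (idRej Ψ) = ⊤
    · have h1 := (h _ ⟨1, one_ne_zero, rfl⟩).2.2.1
      rw [hmeas, htop] at h1
      exact h1 (EReal.coe_add_top 1)
    · have hr : (meas (exec G W) (idRej Ψ)).toReal ≠ 0 := ENNReal.toReal_ne_zero.2 ⟨h0, htop⟩
      have h1 := (h _ ⟨-(meas (exec G W) (idRej Ψ)).toReal, neg_ne_zero.2 hr, rfl⟩).2.1
      rw [hmeas] at h1
      refine h1 ?_
      rw [← EReal.coe_ennreal_toReal htop, ← EReal.coe_add, neg_add_cancel, EReal.coe_zero]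
  · rintro h _ ⟨ζ, hζ, rfl⟩
    refine ⟨hV, ?_⟩
    rw [hmeas, h]
    simp [hζ]

/-! ### Associativity of paths -/

section Assoc

variable {D : Type} {G : Graphing D} {W I : Graphing (Fin 1)}

/-- A step between `G` and `W`, seen as a step between `G` and `W ⊗ I`. -/
def embed (I : Graphing (Fin 1)) : Step G W → Step G (tensor W I)
  | .inl (g, _) => .inl (g, (0, 0))
  | .inr (e, d) => .inr (.inl (e, 0), d)

/-- The step of a path between `G` and `W ⊗ I` along an edge of `I`. -/
def sndStep (i : I.E) (d : D) : Step G (tensor W I) := .inr (.inr (i, 0), d)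

theorem exists_embed_or_sndStep (s : Step G (tensor W I)) :
    (∃ t, s = embed I t) ∨ ∃ i d, s = sndStep i d := by
  rcases s with ⟨g, d⟩ | ⟨⟨e, d'⟩ | ⟨i, d'⟩, d⟩
  · exact Or.inl ⟨.inl (g, 0), by simp only [embed]; congr 2; exact Subsingleton.elim _ _⟩
  · exact Or.inl ⟨.inr (e, d), by simp only [embed]; rw [Subsingleton.elim d' 0]⟩
  · exact Or.inr ⟨i, d, by simp only [sndStep]; rw [Subsingleton.elim d' 0]⟩

theorem sndStep_ne_embed (i : I.E) (d : D) (t : Step G W) : sndStep i d ≠ embed I t := by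
  rcases t with t | t <;> intro h <;> cases h

theorem sndStep_inj {i i' : I.E} {d d' : D}
    (h : (sndStep i d : Step G (tensor W I)) = sndStep i' d') : i = i' ∧ d = d' := by
  cases h
  exact ⟨rfl, rfl⟩

theorem isLeft_embed (s : Step G W) : (embed I s).isLeft = s.isLeft := by
  rcases s with s | s <;> rfl

theorem fst_src_embed (s : Step G W) : (embed I s).src.1 = s.src.1 := by
  rcases s with s | s <;> rfl

theorem fst_tgt_embed (s : Step G W) : (embed I s).tgt.1 = s.tgt.1 := by
  rcases s with s | s <;> rfl

/-- Only the control states of the first graphing matter when the second dialect is trivial. -/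
theorem next_iff {D' : Type} [Subsingleton D'] {F : Graphing D} {H : Graphing D'}
    {s t : Step F H} : Step.Next s t ↔ s.isLeft ≠ t.isLeft ∧ s.tgt.1 = t.src.1 :=
  and_congr_right fun _ =>
    ⟨congrArg Prod.fst, fun h => Prod.ext h (Subsingleton.elim _ _)⟩

theorem next_embed {s t : Step G W} :
    Step.Next (embed I s) (embed I t) ↔ Step.Next s t := by
  simp only [next_iff, isLeft_embed, fst_src_embed, fst_tgt_embed]

theorem run_map_embed (l : List (Step G W)) (x : X) : run (l.map (embed I)) x = run l x := by
  induction l generalizing x with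
  | nil => rfl
  | cons s l ih => rcases s with s | s <;> exact ih _

theorem dom_map_embed (l : List (Step G W)) : dom (l.map (embed I)) = dom l := by
  induction l with
  | nil => rfl
  | cons s l ih => rcases s with s | s <;> simp only [List.map_cons, dom, ih] <;> rfl

variable [Countable D]

/-- The path between `G` and `W ⊗ I` described by one step between `G ⋈ W` and `I`: an edge of
`G ⋈ W` is itself a path, which is unfolded. -/
def unfoldStep : Step (exec G W) I → List (Step G (tensor W I))
  | .inl (l, _) => l.1.map (embed I)
  | .inr (i, d) => [sndStep i d.1]

/-- The path between `G` and `W ⊗ I` described by a path between `G ⋈ W` and `I`. -/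
def unfold (L : List (Step (exec G W) I)) : List (Step G (tensor W I)) := L.flatMap unfoldStep

theorem unfold_append (L M : List (Step (exec G W) I)) :
    unfold (L ++ M) = unfold L ++ unfold M := List.flatMap_append

theorem unfold_cons (s : Step (exec G W) I) (L : List (Step (exec G W) I)) :
    unfold (s :: L) = unfoldStep s ++ unfold L := List.flatMap_cons

theorem run_unfoldStep (s : Step (exec G W) I) (x : X) : run (unfoldStep s) x = s.φ x := by
  rcases s with ⟨l, d⟩ | ⟨i, d⟩
  · exact run_map_embed l.1 x
  · rfl

theorem S_subset_dom_unfoldStep (s : Step (exec G W) I) : s.S ⊆ dom (unfoldStep s) := by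
  rcases s with ⟨l, d⟩ | ⟨i, d⟩
  · intro x hx
    rw [unfoldStep, dom_map_embed]
    exact hx.1.1
  · exact fun x hx => ⟨hx, mem_univ _⟩

theorem run_unfold (L : List (Step (exec G W) I)) (x : X) : run (unfold L) x = run L x := by
  induction L generalizing x with
  | nil => rfl
  | cons s L ih => rw [unfold_cons, run_append, run_unfoldStep, ih]; rfl

theorem dom_subset_dom_unfold (L : List (Step (exec G W) I)) : dom L ⊆ dom (unfold L) := by
  induction L with
  | nil => exact subset_rfl
  | cons s L ih =>
    intro x hx
    rw [unfold_cons, mem_dom_append, run_unfoldStep]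
    exact ⟨S_subset_dom_unfoldStep s hx.1, ih hx.2⟩

theorem S_nonempty_of_mem {D₁ D₂ : Type} {F : Graphing D₁} {H : Graphing D₂}
    {L : List (Step F H)} {s : Step F H} (hs : s ∈ L) (h : (dom L).Nonempty) : s.S.Nonempty := by
  obtain ⟨a, b, rfl⟩ := List.append_of_mem hs
  obtain ⟨x, hx⟩ := h
  exact ⟨_, (mem_dom_append.1 hx).2.1⟩

/-- An edge of `G ⋈ W` with non-empty source starts with an edge of `G`, since all edges of `W`
start in the common part of the supports. -/
theorem isLeft_head_of_exec (hWG : W.V ⊆ G.V) (l : (exec G W).E)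
    (h : ((exec G W).S l).Nonempty) : (l.1.head l.2.1).isLeft := by
  obtain ⟨l, hl⟩ := l
  obtain ⟨x, ⟨hx, hC⟩, -⟩ := h
  rcases l with _ | ⟨s | ⟨e, d⟩, l⟩
  · exact absurd rfl hl.1
  · rfl
  · exact absurd ⟨hWG (W.S_subset e hx.1), W.S_subset e hx.1⟩ hC

/-- An edge of `G ⋈ W` with non-empty source ends with an edge of `G`. -/
theorem isLeft_getLast_of_exec (hWG : W.V ⊆ G.V) (l : (exec G W).E)
    (h : ((exec G W).S l).Nonempty) : (l.1.getLast l.2.1).isLeft := by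
  obtain ⟨l, hl⟩ := l
  obtain ⟨x, ⟨hx, -⟩, hC⟩ := h
  obtain ⟨a, s, rfl⟩ := List.eq_nil_or_concat' l |>.resolve_left hl.1
  rcases s with s | ⟨e, d⟩
  · simp
  · have h1 := W.mapsTo e (mem_dom_append.1 hx).2.1
    have h2 : run (a ++ [Sum.inr (e, d)]) x = W.φ e (run a x) := run_append _ _ _
    simp only [mem_preimage, h2] at hC
    exact absurd ⟨hWG h1, h1⟩ hC

theorem isLeft_unfoldStep_head (hWG : W.V ⊆ G.V) {s : Step (exec G W) I} (h : s.S.Nonempty) :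
    ∀ t ∈ (unfoldStep s).head?, t.isLeft = s.isLeft ∧ t.src.1 = s.src.1.1 := by
  intro t ht
  rcases s with ⟨l, d⟩ | ⟨i, d⟩
  · have h1 := isLeft_head_of_exec hWG l h
    simp only [unfoldStep, List.head?_map, List.head?_eq_some_head l.2.1, Option.map_some,
      Option.mem_def, Option.some.injEq] at ht
    subst ht
    rw [isLeft_embed, fst_src_embed, h1]
    exact ⟨rfl, rfl⟩
  · simp only [unfoldStep, List.head?_cons, Option.mem_def, Option.some.injEq] at ht
    subst ht
    exact ⟨rfl, rfl⟩

theorem isLeft_unfoldStep_getLast (hWG : W.V ⊆ G.V) {s : Step (exec G W) I}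
    (h : s.S.Nonempty) :
    ∀ t ∈ (unfoldStep s).getLast?, t.isLeft = s.isLeft ∧ t.tgt.1 = s.tgt.1.1 := by
  intro t ht
  rcases s with ⟨l, d⟩ | ⟨i, d⟩
  · have h1 := isLeft_getLast_of_exec hWG l h
    simp only [unfoldStep, List.getLast?_map, List.getLast?_eq_some_getLast l.2.1,
      Option.map_some, Option.mem_def, Option.some.injEq] at ht
    subst ht
    rw [isLeft_embed, fst_tgt_embed, h1]
    exact ⟨rfl, rfl⟩
  · simp only [unfoldStep, List.getLast?_singleton, Option.mem_def, Option.some.injEq] at ht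
    subst ht
    exact ⟨rfl, rfl⟩

theorem unfoldStep_ne_nil (s : Step (exec G W) I) : unfoldStep s ≠ [] := by
  rcases s with ⟨l, d⟩ | ⟨i, d⟩
  · simpa [unfoldStep] using l.2.1
  · simp [unfoldStep]

theorem isChain_unfoldStep (s : Step (exec G W) I) : (unfoldStep s).IsChain Step.Next := by
  rcases s with ⟨l, d⟩ | ⟨i, d⟩
  · rw [unfoldStep, List.isChain_map]
    simpa only [next_embed] using l.2.2.1
  · exact List.isChain_singleton _

theorem isChain_unfold (hWG : W.V ⊆ G.V) {L : List (Step (exec G W) I)}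
    (hL : L.IsChain Step.Next) (hS : ∀ s ∈ L, s.S.Nonempty) :
    (unfold L).IsChain Step.Next := by
  rw [unfold, List.flatMap_def, List.isChain_flatten]
  · refine ⟨?_, ?_⟩
    · intro l hl
      obtain ⟨s, -, rfl⟩ := List.mem_map.1 hl
      exact isChain_unfoldStep s
    · rw [List.isChain_map]
      refine hL.imp_of_mem_imp fun s t hs ht hst x hx y hy => ?_
      have h1 := isLeft_unfoldStep_getLast hWG (hS s hs) x hx
      have h2 := isLeft_unfoldStep_head hWG (hS t ht) y hy
      rw [next_iff, h1.1, h2.1, h1.2, h2.2]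
      exact ⟨hst.1, congrArg (fun p => p.1.1) hst.2⟩
  · intro h
    obtain ⟨s, -, hs⟩ := List.mem_map.1 h
    exact unfoldStep_ne_nil s hs

theorem IsLoop.unfold (hWG : W.V ⊆ G.V) {L : List (Step (exec G W) I)} (hL : IsLoop L)
    (hd : (dom L).Nonempty) : IsLoop (unfold L) := by
  refine ⟨?_, ?_⟩
  · rcases L with _ | ⟨s, L⟩
    · exact absurd rfl hL.1
    · rw [unfold_cons]
      exact fun h => unfoldStep_ne_nil s (List.append_eq_nil_iff.1 h).1
  · rw [← unfold_append]
    refine isChain_unfold hWG hL.2 fun s hs => S_nonempty_of_mem (L := L) ?_ hd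
    simpa using hs

/-- Cutting a path between `G` and `W ⊗ I` at its steps in `I`: the parts between them are
edges of `G ⋈ W`. The path is read from its end; `seg` is the part before the first step in `I`,
and `L` the remainder of the path, which starts and ends with a step in `I`. -/
theorem exists_fold (hQ : G.IsQMP) (hQ' : (tensor W I).IsQMP) (hd : Disjoint W.V I.V)
    {i₀ : I.E} {d₀ : D} (π : List (Step G (tensor W I)))
    (hch : (π ++ [sndStep i₀ d₀]).IsChain Step.Next)
    (hv : vol (dom (π ++ [sndStep i₀ d₀])) ≠ 0) :
    ∃ (seg : List (Step G W)) (i : I.E) (d : D) (L M : List (Step (exec G W) I)),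
      π ++ [sndStep i₀ d₀] = seg.map (embed I) ++ unfold L ∧
      L = .inr (i, (d, 0)) :: M ∧ (∃ L', L = L' ++ [.inr (i₀, (d₀, 0))]) ∧
      L.IsChain Step.Next ∧ ∀ x ∈ dom (π ++ [sndStep i₀ d₀]), run seg x ∈ dom L := by
  induction π with
  | nil =>
    exact ⟨[], i₀, d₀, [.inr (i₀, (d₀, 0))], [], rfl, rfl, ⟨[], rfl⟩, List.isChain_singleton _,
      fun x hx => hx⟩
  | cons s π ih =>
    rw [List.cons_append] at hch hv
    obtain ⟨seg, i, d, L, M, hπ, hL, hlast, hLch, hdom⟩ := ih hch.tail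
      (vol_ne_zero_of_subset_preimage_run hQ hQ' [s] (fun x hx => hx.2) hv)
    have hhead : unfold L = sndStep i d :: unfold M := by rw [hL]; rfl
    rcases exists_embed_or_sndStep s with ⟨t, rfl⟩ | ⟨i', d', rfl⟩
    · refine ⟨t :: seg, i, d, L, M, ?_, hL, hlast, hLch, fun x hx => ?_⟩
      · rw [List.cons_append, hπ]; rfl
      · have h := hdom _ hx.2
        rcases t with t | t <;> exact h
    · rw [hπ] at hch
      have hseg : seg ≠ [] := by
        rintro rfl
        rw [hhead] at hch
        exact (List.isChain_cons_cons.1 hch).1.1 rfl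
      have halt : IsAltPath seg := by
        refine ⟨hseg, ?_, ?_⟩
        · have h := hch.tail.left_of_append
          rw [List.isChain_map] at h
          simpa only [next_embed] using h
        · refine vol_ne_zero_of_subset_preimage_run hQ hQ' [sndStep i' d'] (fun x hx => ?_) hv
          have h : I.φ i' x ∈ dom (π ++ [sndStep i₀ d₀]) := hx.2
          rw [hπ, mem_dom_append, dom_map_embed] at h
          exact h.1
      have hC : ∀ y ∈ I.V, y ∈ (G.V ∩ W.V)ᶜ := fun y hy h => hd.le_bot ⟨h.2, hy⟩
      refine ⟨[], i', d', .inr (i', (d', 0)) :: .inl (⟨seg, halt⟩, 0) :: L,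
        .inl (⟨seg, halt⟩, 0) :: L, ?_, rfl, ?_, ?_, fun x hx => ⟨hx.1, ⟨⟨?_, ?_⟩, ?_⟩, ?_⟩⟩
      · rw [List.cons_append, hπ]; rfl
      · obtain ⟨L', rfl⟩ := hlast
        exact ⟨_ :: _ :: L', rfl⟩
      · refine List.isChain_cons_cons.2 ⟨next_iff.2 ⟨by simp, ?_⟩, ?_⟩
        · have h := (List.isChain_cons.1 hch).1 (embed I (seg.head hseg))
            (by simp [List.head?_append, List.head?_eq_some_head hseg])
          have h' := (next_iff.1 h).2
          rw [fst_src_embed] at h'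
          exact Prod.ext h' (Subsingleton.elim _ _)
        · rw [hL]
          refine List.isChain_cons_cons.2 ⟨next_iff.2 ⟨by simp, ?_⟩, hL ▸ hLch⟩
          have h := (List.isChain_append.1 hch.tail).2.2 (embed I (seg.getLast hseg))
            (by simp [List.getLast?_eq_some_getLast hseg]) (sndStep i d) (by simp [hhead])
          have h' := (next_iff.1 h).2
          rw [fst_tgt_embed] at h'
          exact Prod.ext h' (Subsingleton.elim _ _)
      · have h : I.φ i' x ∈ dom (π ++ [sndStep i₀ d₀]) := hx.2
        rw [hπ, mem_dom_append, dom_map_embed] at h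
        exact h.1
      · exact hC _ (I.mapsTo i' hx.1)
      · have h := hdom _ hx.2
        rw [hL] at h
        exact hC _ (I.S_subset i h.1)
      · exact hdom _ hx.2

/-- Cycles between `G ⋈ W` and `I` are the cycles between `G` and `W ⊗ I` using an edge of `I`. -/
theorem exists_loop_exec_iff (hG : G.IsQMP) (hQ : (tensor W I).IsQMP) (hWG : W.V ⊆ G.V)
    (hd : Disjoint W.V I.V) :
    (∃ L : List (Step (exec G W) I), IsLoop L ∧ vol (fixSet L) ≠ 0) ↔
      ∃ π : List (Step G (tensor W I)), IsLoop π ∧ (∃ i d, sndStep i d ∈ π) ∧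
        vol (fixSet π) ≠ 0 := by
  constructor
  · rintro ⟨L, hL, hv⟩
    obtain ⟨x, hx⟩ := nonempty_of_measure_ne_zero hv
    refine ⟨unfold L, hL.unfold hWG ⟨x, hx.1⟩, ?_, fun h0 => hv (measure_mono_null ?_ h0)⟩
    · obtain ⟨s | ⟨i, d⟩, hs, hs'⟩ := hL.exists_isRight
      · simp at hs'
      · exact ⟨i, d.1, List.mem_flatMap.2 ⟨_, hs, by simp [unfoldStep]⟩⟩
    · exact fun y hy => ⟨dom_subset_dom_unfold L hy.1, by rw [run_unfold]; exact hy.2⟩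
  · rintro ⟨π, hπ, ⟨i₀, d₀, hmem⟩, hv⟩
    obtain ⟨a, b, rfl⟩ := List.append_of_mem hmem
    rw [List.append_cons] at hπ hv
    replace hπ := hπ.append_comm
    replace hv := vol_fixSet_append_comm hG hQ hv
    rw [← List.append_assoc] at hπ hv
    generalize b ++ a = ρ at hπ hv
    -- The cycle `ρ` followed by the step in `I` is read from the point before that step.
    have hsub : ∀ x ∈ fixSet (ρ ++ [sndStep i₀ d₀]),
        run ρ x ∈ dom ((sndStep i₀ d₀ :: ρ) ++ [sndStep i₀ d₀]) ∧ I.φ i₀ (run ρ x) = x := by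
      intro x hx
      have h1 : I.φ i₀ (run ρ x) = x := by
        have h2 := hx.2
        rw [run_append] at h2
        exact h2
      refine ⟨⟨(mem_dom_append.1 hx.1).2.1, ?_⟩, h1⟩
      change I.φ i₀ (run ρ x) ∈ dom (ρ ++ [sndStep i₀ d₀])
      rw [h1]
      exact hx.1
    have hch : ((sndStep i₀ d₀ :: ρ) ++ [sndStep i₀ d₀]).IsChain Step.Next :=
      hπ.2.infix ⟨ρ, [], by simp⟩
    obtain ⟨seg, i, d, L, M, hL, rfl, ⟨L', hL'⟩, hLch, hdom⟩ := exists_fold hG hQ hd _ hch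
      (vol_ne_zero_of_subset_preimage_run hG hQ ρ (fun x hx => (hsub x hx).1) hv)
    obtain rfl : seg = [] := by
      rcases seg with _ | ⟨t, seg⟩
      · rfl
      · exact absurd (List.cons.inj hL).1 (sndStep_ne_embed i₀ d₀ t)
    have hL2 : sndStep i₀ d₀ :: (ρ ++ [sndStep i₀ d₀]) = sndStep i d :: unfold M := hL
    obtain ⟨hstep, hM⟩ := List.cons.inj hL2
    obtain ⟨rfl, rfl⟩ := sndStep_inj hstep
    rcases L' with _ | ⟨s, L'⟩
    · obtain rfl : M = [] := by simpa using hL'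
      simp [unfold] at hM
    obtain rfl : M = L' ++ [.inr (i₀, (d₀, 0))] := (List.cons.inj hL').2
    refine ⟨_, ⟨by simp, List.IsChain.append_overlap hLch.tail hLch (by simp)⟩,
      fun h0 => hv (measure_mono_null ?_ h0)⟩
    refine fun x hx => ⟨?_, ?_⟩
    · have h := (hdom _ (hsub x hx).1).2
      change I.φ i₀ (run ρ x) ∈ dom (L' ++ [.inr (i₀, (d₀, 0))]) at h
      rwa [(hsub x hx).2] at h
    · rw [← run_unfold, ← hM]
      exact hx.2

end Assoc

/-! ### Cycles through a region -/

section Through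

variable {D : Type} {G : Graphing D} {W I : Graphing (Fin 1)} {R : Set X}

theorem mem_visits_of_sndStep_mem (hI : ∀ i, I.S i ⊆ R) {π : List (Step G (tensor W I))} {i : I.E}
    {d : D} (hmem : sndStep i d ∈ π) {x : X} (hx : x ∈ dom π) : x ∈ visits π R := by
  obtain ⟨a, b, rfl⟩ := List.append_of_mem hmem
  exact ⟨a, List.prefix_append _ _, hI i (mem_dom_append.1 hx).2.1⟩

/-- A periodic trajectory meeting a region disjoint from the support of `W` uses an edge of `I`:
of the two steps around a point of the region, one is not in `G`, hence it is in `I`. -/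
theorem exists_sndStep_of_mem_visits (hR : Disjoint W.V R) {π : List (Step G (tensor W I))}
    (hπ : IsLoop π) {x : X} (hx : x ∈ fixSet π) (hxR : x ∈ visits π R) :
    ∃ i d, sndStep i d ∈ π := by
  obtain ⟨a, ⟨b, rfl⟩, hyR⟩ := hxR
  have hy : run a x ∈ fixSet (b ++ a) := fixSet_append_subset a b hx
  have hρ := hπ.append_comm
  suffices h : ∃ i d, sndStep i d ∈ b ++ a by
    obtain ⟨i, d, h⟩ := h
    exact ⟨i, d, by simpa [or_comm] using h⟩
  generalize run a x = y at hy hyR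
  generalize b ++ a = ρ at hy hρ
  clear hπ hx
  obtain ⟨hne, hch⟩ := hρ
  have hW : y ∉ W.V := fun h => hR.le_bot ⟨h, hyR⟩
  rcases ρ with _ | ⟨s, ρ⟩
  · exact absurd rfl hne
  rcases exists_embed_or_sndStep s with ⟨g | ⟨e, d⟩, rfl⟩ | ⟨i, d, rfl⟩
  · obtain ⟨τ, t, hτ⟩ := (List.eq_nil_or_concat' (embed I (Sum.inl g) :: ρ)).resolve_left hne
    have hnext : Step.Next t (embed I (Sum.inl g)) :=
      (List.isChain_append.1 hch).2.2 t (by simp [hτ]) _ (by simp)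
    rw [hτ] at hy ⊢
    have hyt : t.φ (run τ y) = y := by
      have h := hy.2
      rwa [run_append] at h
    rcases exists_embed_or_sndStep t with ⟨g' | ⟨e, d⟩, rfl⟩ | ⟨i, d, rfl⟩
    · exact absurd rfl hnext.1
    · exact absurd (hyt ▸ W.mapsTo e (mem_dom_append.1 hy.1).2.1) hW
    · exact ⟨i, d, by simp⟩
  · exact absurd (W.S_subset e hy.1.1) hW
  · exact ⟨i, d, by simp⟩

theorem exists_isCycleThrough_iff (hI : ∀ i, I.S i ⊆ R) (hR : Disjoint W.V R) :
    (∃ π : List (Step G (tensor W I)), IsCycleThrough π R) ↔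
      ∃ π : List (Step G (tensor W I)), IsLoop π ∧ (∃ i d, sndStep i d ∈ π) ∧
        vol (fixSet π) ≠ 0 := by
  constructor
  · rintro ⟨π, hπ, hv⟩
    obtain ⟨x, hx, hxR, hfix⟩ := nonempty_of_measure_ne_zero hv
    have hl := (isClosedPath_iff.1 hπ).1
    exact ⟨π, hl, exists_sndStep_of_mem_visits hR hl ⟨hx, hfix⟩ hxR,
      fun h0 => hv (measure_mono_null (t := fixSet π) (fun y hy => ⟨hy.1, hy.2.2⟩) h0)⟩
  · rintro ⟨π, hπ, ⟨i, d, hmem⟩, hv⟩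
    refine ⟨π, isClosedPath_iff.2 ⟨hπ, dom_ne_zero_of_fixSet hv⟩,
      fun h0 => hv (measure_mono_null (s := fixSet π) ?_ h0)⟩
    exact fun y hy => ⟨hy.1, mem_visits_of_sndStep_mem hI hmem hy.1, hy.2⟩

theorem visits_subset_visits_pow {D₁ D₂ : Type} {F : Graphing D₁} {H : Graphing D₂}
    (l : List (Step F H)) {k : ℕ} (hk : 0 < k) : visits l R ⊆ visits (pow l k) R := by
  obtain ⟨k, rfl⟩ := Nat.exists_eq_succ_of_ne_zero hk.ne'
  rintro x ⟨l', hl', hx⟩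
  refine ⟨l', hl'.trans ?_, hx⟩
  rw [pow_succ_path]
  exact List.prefix_append _ _

theorem IsCycleThrough.isIterable {D₁ D₂ : Type} {F : Graphing D₁} {H : Graphing D₂}
    {l : List (Step F H)} (h : IsCycleThrough l R) : IsIterableCycleThrough l R := by
  refine ⟨h.1, fun k hk h0 => h.2 (measure_mono_null ?_ h0)⟩
  rintro x ⟨hx, hxR, hfix⟩
  refine ⟨mem_dom_pow.2 fun j _ => ?_, hxR⟩
  have hj : (run l)^[j] x = x := Function.iterate_fixed hfix j
  rwa [hj]

/-- An iterable cycle yields a cycle as soon as some iterate of its realiser is almost everywhere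
the identity. -/
theorem IsIterableCycleThrough.isCycleThrough_pow {D₁ D₂ : Type} {F : Graphing D₁}
    {H : Graphing D₂} {l : List (Step F H)} (h : IsIterableCycleThrough l R) {m : ℕ} (hm : 0 < m)
    (hid : ∀ᵐ x ∂vol, (run l)^[m] x = x) : IsCycleThrough (pow l m) R := by
  have hl := (isClosedPath_iff.1 h.1).1
  have hv : vol {x | x ∈ dom (pow l m) ∧ x ∈ visits (pow l m) R ∧ run (pow l m) x = x} ≠ 0 := by
    intro h0
    refine h.2 m hm (measure_mono_null (t := _ ∪ {x | ¬ (run l)^[m] x = x}) ?_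
      (measure_union_null h0 (ae_iff.1 hid)))
    rintro x ⟨hx, hxR⟩
    by_cases hf : (run l)^[m] x = x
    · exact Or.inl ⟨hx, visits_subset_visits_pow l hm hxR, by rwa [run_pow]⟩
    · exact Or.inr hf
  exact ⟨isClosedPath_iff.2 ⟨hl.pow hm,
    fun h0 => hv (measure_mono_null (fun _ hx => hx.1) h0)⟩, hv⟩

end Through

/-! ### Rotations of the coordinates -/

theorem rot_rot (c d : ℝ) (x : I01) : rot c (rot d x) = rot (d + c) x := by
  apply Subtype.ext
  simp only [rot]
  rw [Int.fract_eq_fract]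
  refine ⟨-⌊(x : ℝ) + d⌋, ?_⟩
  rw [Int.fract]
  push_cast
  ring

theorem rot_ne_one (c : ℝ) (x : I01) : rot c x ≠ 1 :=
  fun h => (Int.fract_lt_one ((x : ℝ) + c)).ne (congrArg Subtype.val h)

/-- The point `1` is excluded, as a rotation sends it to the point `0` identified with it. -/
theorem rot_intCast (m : ℤ) {x : I01} (hx : x ≠ 1) : rot m x = x := by
  apply Subtype.ext
  simp only [rot, Int.fract_add_intCast]
  exact Int.fract_eq_self.2 ⟨x.2.1, lt_of_le_of_ne x.2.2 fun h => hx (Subtype.ext h)⟩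

theorem measurePreserving_rot (c : ℝ) : MeasurePreserving (rot c) volume volume := by
  refine ⟨measurable_rot c, ?_⟩
  ext A hA
  rw [Measure.map_apply (measurable_rot c) hA]
  -- `B` is the periodic set of reals with fractional part in `A`.
  set r : ℝ → I01 := fun y => ⟨Int.fract y, Int.fract_nonneg _, (Int.fract_lt_one _).le⟩ with hr
  have hrm : Measurable r := Measurable.subtype_mk (by fun_prop)
  set B : Set ℝ := r ⁻¹' A with hB
  have hBm : MeasurableSet B := hrm hA
  have hunit : ∀ C : Set ℝ, MeasurableSet C →
      (volume : Measure I01) (Subtype.val ⁻¹' C) = volume (C ∩ Ioc 0 1) := by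
    intro C hC
    rw [unitInterval.measurePreserving_coe.measure_preimage hC.nullMeasurableSet,
      Measure.restrict_congr_set Ioc_ae_eq_Icc.symm, Measure.restrict_apply hC]
  have h1 : rot c ⁻¹' A = Subtype.val ⁻¹' ((fun y => y + c) ⁻¹' B) := rfl
  have h2 : (fun y : ℝ => y + c) ⁻¹' B ∩ Ioc 0 1 = (fun y => y + c) ⁻¹' (B ∩ Ioc c (c + 1)) := by
    ext y
    simp only [mem_inter_iff, mem_preimage, mem_Ioc]
    constructor <;> rintro ⟨h, h', h''⟩ <;> exact ⟨h, by linarith, by linarith⟩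
  have h3 : volume (B ∩ Ioc c (c + 1)) = volume (B ∩ Ioc (0 : ℝ) (0 + 1)) := by
    refine (isAddFundamentalDomain_Ioc one_pos c).measure_set_eq
      (isAddFundamentalDomain_Ioc one_pos 0) hBm ?_
    rintro ⟨g, hg⟩
    obtain ⟨m, rfl⟩ := AddSubgroup.mem_zmultiples_iff.1 hg
    ext y
    have : r (m • (1 : ℝ) + y) = r y := by
      apply Subtype.ext
      simp [hr]
    simp only [hB, mem_preimage, AddSubgroup.mk_vadd, vadd_eq_add, this]
  rw [h1, hunit _ (hBm.preimage (by fun_prop)), h2, measure_preimage_add_right, h3, zero_add,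
    ← hunit B hBm]
  refine measure_congr ?_
  have hne : ∀ᵐ x : I01, x ≠ 1 := by simp [ae_iff]
  filter_upwards [hne] with x hx
  have : r x = x := by
    refine Eq.trans ?_ (rot_intCast 0 hx)
    simp [hr, rot]
  exact congrArg A this

section CoordRot

variable (P : I01 × I01 ≃ᵐ I01)

/-- The rotation by `q / N` of the first component of `t = [x, y]`. -/
noncomputable def coordRot (N : ℕ) (q : ℤ) (t : I01) : I01 :=
  P (rot ((q : ℝ) / N) (P.symm t).1, (P.symm t).2)

theorem coordRot_coordRot (N : ℕ) (q q' : ℤ) (t : I01) :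
    coordRot P N q (coordRot P N q' t) = coordRot P N (q + q') t := by
  simp only [coordRot, MeasurableEquiv.symm_apply_apply, rot_rot]
  congr 3
  push_cast
  ring

theorem coordRot_mul {N : ℕ} (hN : N ≠ 0) (q : ℤ) {t : I01} (ht : (P.symm t).1 ≠ 1) :
    coordRot P N (N * q) t = t := by
  have h : (((N * q : ℤ) : ℝ)) / N = (q : ℝ) := by
    push_cast
    field_simp
  rw [coordRot, h, rot_intCast q ht]
  exact P.apply_symm_apply t

theorem measurePreserving_coordRot {P : I01 × I01 ≃ᵐ I01} (hP : MeasurePreserving P volume volume)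
    (N : ℕ) (q : ℤ) : MeasurePreserving (coordRot P N q) volume volume := by
  have h : MeasurePreserving (Prod.map (rot ((q : ℝ) / N)) (id : I01 → I01)) volume volume :=
    (measurePreserving_rot _).prod (MeasurePreserving.id _)
  exact hP.comp (h.comp (hP.symm P))

theorem pushMap_transl (N d d' : ℕ) (z : ℤ) (p : X) :
    pushMap P N d d' (transl z) p =
      (p.1 + z, fun k => (if k = 0 then coordRot P N ((d' : ℤ) - d) else id) (p.2 k)) := by
  refine Prod.ext rfl (funext fun k => ?_)
  cases k with
  | zero => simp [pushMap, cons, coordRot]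
  | succ k => rfl

theorem measurePreserving_pushMap_transl {P : I01 × I01 ≃ᵐ I01}
    (hP : MeasurePreserving P volume volume) (N d d' : ℕ) (z : ℤ) :
    MeasurePreserving (pushMap P N d d' (transl z)) vol vol := by
  set g : ℕ → I01 → I01 := fun k => if k = 0 then coordRot P N ((d' : ℤ) - d) else id with hg
  have hgp : ∀ k, MeasurePreserving (g k) volume volume := by
    intro k
    by_cases hk : k = 0
    · simpa [hg, hk] using measurePreserving_coordRot hP N ((d' : ℤ) - d)
    · simpa [hg, hk] using MeasurePreserving.id (volume : Measure I01)
  have hpi : MeasurePreserving (fun (s : ℕ → I01) k => g k (s k))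
      (Measure.infinitePi fun _ : ℕ => (volume : Measure I01))
      (Measure.infinitePi fun _ : ℕ => (volume : Measure I01)) := by
    refine ⟨measurable_pi_lambda _ fun k =>
      (hgp k).measurable.comp (measurable_pi_apply k), ?_⟩
    rw [Measure.infinitePi_map_pi _ fun k => (hgp k).measurable]
    congr 1
    exact funext fun k => (hgp k).map_eq
  have h : pushMap P N d d' (transl z) =
      transl z ∘ Prod.map id (fun (s : ℕ → I01) k => g k (s k)) :=
    funext fun p => pushMap_transl P N d d' z p
  rw [h]
  exact (measurePreserving_transl z).comp ((MeasurePreserving.id _).prod hpi)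

end CoordRot

/-! ### Twisted maps -/

section Twisted

variable (P : I01 × I01 ≃ᵐ I01) (N : ℕ)

/-- The map translating the integer component by `z`, permuting the coordinates by `σ` and
rotating the `k`-th one by `q k / N`. -/
noncomputable def twist (z : ℤ) (σ : Equiv.Perm ℕ) (q : ℕ → ℤ) : X → X :=
  fun p => (p.1 + z, fun k => coordRot P N (q k) (p.2 (σ k)))

/-- The points none of whose coordinates is of the form `[1, y]`: on these points, rotations by
integers are the identity. -/
def goodSet : Set X := {p | ∀ k, (P.symm (p.2 k)).1 ≠ 1}

/-- `f` agrees on the good points with a twist permuting finitely many coordinates. -/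
def IsTwisted (f : X → X) : Prop :=
  ∃ (z : ℤ) (σ : Equiv.Perm ℕ) (q : ℕ → ℤ), (∃ i, ∀ k, i ≤ k → σ k = k) ∧
    EqOn f (twist P N z σ q) (goodSet P)

variable {P N}

theorem ae_mem_goodSet (hP : MeasurePreserving P volume volume) : ∀ᵐ p ∂vol, p ∈ goodSet P := by
  refine ae_all_iff.2 fun k => ?_
  have h : Measure.QuasiMeasurePreserving (fun p : X => (P.symm (p.2 k)).1) vol volume :=
    Measure.quasiMeasurePreserving_fst.comp ((hP.symm P).quasiMeasurePreserving.comp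
      ((measurePreserving_eval_infinitePi (fun _ : ℕ => (volume : Measure I01))
        k).quasiMeasurePreserving.comp Measure.quasiMeasurePreserving_snd))
  have h0 := h.preimage_null (measure_singleton (1 : I01))
  rwa [ae_iff, show {p : X | ¬ (P.symm (p.2 k)).1 ≠ 1} =
    (fun p : X => (P.symm (p.2 k)).1) ⁻¹' {1} by ext; simp]

theorem twist_mem_goodSet (z : ℤ) (σ : Equiv.Perm ℕ) (q : ℕ → ℤ) (p : X) :
    twist P N z σ q p ∈ goodSet P := by
  intro k
  simp only [twist, coordRot, MeasurableEquiv.symm_apply_apply]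
  exact rot_ne_one _ _

theorem twist_twist (z z' : ℤ) (σ σ' : Equiv.Perm ℕ) (q q' : ℕ → ℤ) (p : X) :
    twist P N z σ q (twist P N z' σ' q' p) =
      twist P N (z' + z) (σ' * σ) (fun k => q k + q' (σ k)) p := by
  refine Prod.ext (add_assoc _ _ _) (funext fun k => ?_)
  exact coordRot_coordRot P N _ _ _

theorem coordRot_zero (hN : N ≠ 0) {t : I01} (ht : (P.symm t).1 ≠ 1) : coordRot P N 0 t = t := by
  simpa using coordRot_mul P hN 0 ht

theorem IsTwisted.id (hN : N ≠ 0) : IsTwisted P N id :=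
  ⟨0, 1, 0, ⟨0, fun _ _ => rfl⟩, fun p hp =>
    Prod.ext (add_zero p.1).symm (funext fun k => (coordRot_zero hN (hp k)).symm)⟩

theorem isTwisted_transl (hN : N ≠ 0) (z : ℤ) : IsTwisted P N (transl z) :=
  ⟨z, 1, 0, ⟨0, fun _ _ => rfl⟩, fun _ hp =>
    Prod.ext rfl (funext fun k => (coordRot_zero hN (hp k)).symm)⟩

theorem isTwisted_permMap (hN : N ≠ 0) {σ : Equiv.Perm ℕ} {i : ℕ} (hσ : ∀ k, i ≤ k → σ k = k) :
    IsTwisted P N (permMap σ) :=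
  ⟨0, σ, 0, ⟨i, hσ⟩, fun p hp =>
    Prod.ext (add_zero p.1).symm (funext fun k => (coordRot_zero hN (hp (σ k))).symm)⟩

theorem isTwisted_pushMap_transl (hN : N ≠ 0) (d d' : ℕ) (z : ℤ) :
    IsTwisted P N (pushMap P N d d' (transl z)) := by
  refine ⟨z, 1, fun k => if k = 0 then (d' : ℤ) - d else 0, ⟨0, fun _ _ => rfl⟩, fun p hp => ?_⟩
  rw [pushMap_transl]
  refine Prod.ext rfl (funext fun k => ?_)
  by_cases hk : k = 0
  · simp [twist, hk]
  · simp [twist, hk, coordRot_zero hN (hp k)]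

theorem IsTwisted.comp {f g : X → X} (hf : IsTwisted P N f) (hg : IsTwisted P N g) :
    IsTwisted P N (f ∘ g) := by
  obtain ⟨z, σ, q, ⟨i, hi⟩, hf⟩ := hf
  obtain ⟨z', σ', q', ⟨i', hi'⟩, hg⟩ := hg
  refine ⟨z' + z, σ' * σ, fun k => q k + q' (σ k), ⟨max i i', fun k hk => ?_⟩, fun p hp => ?_⟩
  · rw [Equiv.Perm.mul_apply, hi k (le_of_max_le_left hk), hi' k (le_of_max_le_right hk)]
  · rw [Function.comp_apply, hg hp, hf (twist_mem_goodSet _ _ _ _), twist_twist]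

theorem isTwisted_of_mem_mInfty (hN : N ≠ 0) {f : X → X} (hf : f ∈ mInfty.maps) :
    IsTwisted P N f := by
  obtain ⟨i, hi⟩ := mem_iUnion.1 hf
  clear hf
  induction (show Generated i f from hi) with
  | id => exact .id hN
  | transl z => exact isTwisted_transl hN z
  | perm σ hσ => exact isTwisted_permMap hN hσ
  | comp f g hf hg ihf ihg => exact (ihf hf).comp (ihg hg)

theorem isTwisted_run (hN : N ≠ 0) {D D' : Type} {F : Graphing D} {G : Graphing D'}
    (hF : ∀ e, IsTwisted P N (F.φ e)) (hG : ∀ e, IsTwisted P N (G.φ e)) (l : List (Step F G)) :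
    IsTwisted P N (run l) := by
  induction l with
  | nil => exact .id hN
  | cons s l ih =>
    rcases s with ⟨e, d⟩ | ⟨e, d⟩
    · exact ih.comp (hF e)
    · exact ih.comp (hG e)

theorem iterate_twist (z : ℤ) (σ : Equiv.Perm ℕ) (q : ℕ → ℤ) (m : ℕ) :
    ∃ q', (twist P N z σ q)^[m + 1] = twist P N ((m + 1 : ℕ) * z) (σ ^ (m + 1)) q' := by
  induction m with
  | zero => exact ⟨q, by simp⟩
  | succ m ih =>
    obtain ⟨q', h⟩ := ih
    refine ⟨fun k => q k + q' (σ k), ?_⟩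
    rw [Function.iterate_succ', h]
    ext1 p
    rw [Function.comp_apply, twist_twist, ← pow_succ]
    congr 1
    push_cast
    ring

theorem iterate_twist_one (z : ℤ) (q : ℕ → ℤ) (m : ℕ) :
    (twist P N z 1 q)^[m + 1] =
      twist P N ((m + 1 : ℕ) * z) 1 (fun k => (m + 1 : ℕ) * q k) := by
  induction m with
  | zero => simp
  | succ m ih =>
    rw [Function.iterate_succ', ih]
    ext1 p
    rw [Function.comp_apply, twist_twist, one_mul]
    congr 1
    · push_cast
      ring
    · ext k
      simp only [Equiv.Perm.one_apply]
      push_cast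
      ring

theorem isOfFinOrder_of_forall_ge {σ : Equiv.Perm ℕ} {i : ℕ} (hσ : ∀ k, i ≤ k → σ k = k) :
    IsOfFinOrder σ := by
  have h1 : ∀ k, σ k < i ↔ k < i := by
    intro k
    constructor
    · intro h
      by_contra! hk
      rw [hσ k hk] at h
      omega
    · intro h
      by_contra! hk
      rw [σ.injective (hσ _ hk)] at hk
      omega
  have h2 : ∀ k, σ k ≠ k → k < i := fun k hk => by
    by_contra! h
    exact hk (hσ k h)
  rw [← Equiv.Perm.ofSubtype_subtypePerm h1 h2]
  have : Finite {k : ℕ // k < i} := (finite_Iio i).to_subtype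
  exact MonoidHom.isOfFinOrder _ (isOfFinOrder_of_finite _)

theorem eqOn_iterate_twist {f : X → X} {z : ℤ} {σ : Equiv.Perm ℕ} {q : ℕ → ℤ}
    (h : EqOn f (twist P N z σ q) (goodSet P)) (m : ℕ) :
    EqOn f^[m] (twist P N z σ q)^[m] (goodSet P) := by
  induction m with
  | zero => exact fun _ _ => rfl
  | succ m ih =>
    intro p hp
    rw [Function.iterate_succ_apply, Function.iterate_succ_apply, h hp]
    exact ih (twist_mem_goodSet _ _ _ _)

/-- A twisted map whose iterates keep good points in a bounded region for arbitrarily long times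
does not translate the integer component. Its finite permutation and its rotations, by multiples
of `1 / N`, have finite order, so an iterate of the map is the identity. -/
theorem IsTwisted.exists_iterate_eqOn_id (hN : N ≠ 0) {f : X → X} (hf : IsTwisted P N f) (B : ℕ)
    (hB : ∀ k : ℕ, ∃ x ∈ goodSet P, ∀ j < k, |(f^[j] x).1| ≤ B) :
    ∃ m, 0 < m ∧ EqOn f^[m] _root_.id (goodSet P) := by
  obtain ⟨z, σ, q, ⟨i, hσ⟩, hf⟩ := hf
  have hz : z = 0 := by
    obtain ⟨x, hx, hxB⟩ := hB (2 * B + 2)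
    have h0 := hxB 0 (by omega)
    have h1 := hxB (2 * B + 1) (by omega)
    obtain ⟨q', hq'⟩ := iterate_twist (P := P) (N := N) z σ q (2 * B)
    rw [eqOn_iterate_twist hf _ hx, hq'] at h1
    simp only [twist, Function.iterate_zero, id_eq] at h0 h1
    rw [abs_le] at h0 h1
    push_cast at h1
    by_contra hz
    rcases lt_or_gt_of_ne hz with hz | hz <;> nlinarith
  subst hz
  obtain ⟨m, hm, hσm⟩ := (isOfFinOrder_of_forall_ge hσ).exists_pow_eq_one
  obtain ⟨m, rfl⟩ := Nat.exists_eq_succ_of_ne_zero hm.ne'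
  obtain ⟨n, rfl⟩ := Nat.exists_eq_succ_of_ne_zero hN
  obtain ⟨q', hq'⟩ := iterate_twist (P := P) (N := n + 1) 0 σ q m
  refine ⟨(m + 1) * (n + 1), by positivity, fun p hp => ?_⟩
  rw [eqOn_iterate_twist hf _ hp, Function.iterate_mul, hq', hσm, mul_zero, iterate_twist_one]
  refine Prod.ext (by simp [twist]) (funext fun k => ?_)
  exact coordRot_mul P hN (q' k) (hp k)

end Twisted

/-! ### Machines and word representations -/

theorem finite_vertex : Finite Vertex := by
  let f : (Option Bool × Bool) ⊕ Bool → Vertex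
    | .inl (s, b) => .sym s (if b then .inn else .out)
    | .inr b => if b then .acc else .rej
  refine Finite.of_surjective f ?_
  rintro (⟨s, _ | _⟩ | _ | _)
  · exact ⟨.inl (s, true), rfl⟩
  · exact ⟨.inl (s, false), rfl⟩
  · exact ⟨.inr true, rfl⟩
  · exact ⟨.inr false, rfl⟩

theorem exists_abs_le_of_mem_region (Ψ : Vertex → ℤ) :
    ∃ B : ℕ, ∀ T, ∀ p ∈ region Ψ T, |p.1| ≤ B := by
  have := finite_vertex
  obtain ⟨B, hB⟩ := (finite_range fun v => (Ψ v).natAbs).bddAbove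
  refine ⟨B, fun T p hp => ?_⟩
  obtain ⟨v, -, hv⟩ := hp
  rw [← hv, Int.abs_eq_natAbs]
  exact_mod_cast hB ⟨v, rfl⟩

theorem disjoint_wordSupport_resultSupport {Ψ : Vertex → ℤ} (hΨ : Function.Injective Ψ) :
    Disjoint (wordSupport Ψ) (resultSupport Ψ) := by
  refine Set.disjoint_left.2 ?_
  rintro p ⟨v, ⟨s, d, rfl⟩, hv⟩ ⟨v', hv', hp⟩
  rw [← hv] at hp
  rcases hv' with rfl | rfl <;> simpa using hΨ hp

theorem rejRegion_subset_resultSupport (Ψ : Vertex → ℤ) : rejRegion Ψ ⊆ resultSupport Ψ :=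
  fun _ hp => image_mono (by simp) hp

section Words

variable {P : I01 × I01 ≃ᵐ I01} {Ψ : Vertex → ℤ} (w : List Bool) {n : ℕ}
  (ι : Fin (w.length + 1) ↪ Fin (n + 1))

theorem isQMP_wordRep (hP : MeasurePreserving P volume volume) : (wordRep P Ψ w ι).IsQMP :=
  fun _ => (measurePreserving_pushMap_transl hP _ _ _ _).quasiMeasurePreserving

theorem isTwisted_wordRep (e : (wordRep P Ψ w ι).E) :
    IsTwisted P (n + 1) ((wordRep P Ψ w ι).φ e) :=
  isTwisted_pushMap_transl n.succ_ne_zero _ _ _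

end Words

theorem isQMP_idRej (Ψ : Vertex → ℤ) : (idRej Ψ).IsQMP :=
  fun _ => Measure.QuasiMeasurePreserving.id vol

theorem isQMP_tensor {D D' : Type} [Countable D] [Countable D'] {F : Graphing D}
    {G : Graphing D'} (hF : F.IsQMP) (hG : G.IsQMP) : (tensor F G).IsQMP :=
  fun s => s.quasiMeasurePreserving hF hG

/-- For realisers in `𝔪_∞`, an iterable cycle for `G` and `!W ⊗ Id_[r]` has a power whose
realiser is almost everywhere the identity. -/
theorem exists_iterate_run_ae_eq {P : I01 × I01 ≃ᵐ I01} (hP : MeasurePreserving P volume volume)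
    {Ψ : Vertex → ℤ} {D : Type} {G : Graphing D} (hV : G.V = wordSupport Ψ ∪ resultSupport Ψ)
    (hG : ∀ e, G.φ e ∈ mInfty.maps) {w : List Bool} {n : ℕ}
    {ι : Fin (w.length + 1) ↪ Fin (n + 1)} {R : Set X}
    {π : List (Step G (tensor (wordRep P Ψ w ι) (idRej Ψ)))} (hπ : IsIterableCycleThrough π R) :
    ∃ m, 0 < m ∧ ∀ᵐ x ∂vol, (run π)^[m] x = x := by
  have hN : n + 1 ≠ 0 := n.succ_ne_zero
  have htw : IsTwisted P (n + 1) (run π) := by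
    refine isTwisted_run hN (fun e => isTwisted_of_mem_mInfty hN (hG e)) ?_ π
    rintro (⟨e, d⟩ | ⟨e, d⟩)
    · exact isTwisted_wordRep w ι e
    · exact IsTwisted.id hN
  obtain ⟨B, hB⟩ := exists_abs_le_of_mem_region Ψ
  have hdomB : ∀ x ∈ dom π, |x.1| ≤ B := by
    intro x hx
    rcases dom_subset hπ.1.1.1 hx with h | h | h
    · rw [hV] at h
      rcases h with h | h <;> exact hB _ _ h
    · exact hB extVertices _ h
    · exact hB _ _ h
  obtain ⟨m, hm, hid⟩ := htw.exists_iterate_eqOn_id hN B (by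
    intro k
    obtain ⟨x, ⟨hx, -⟩, hxg⟩ : ({x | x ∈ dom (pow π (k + 1)) ∧ x ∈ visits π R} ∩
        goodSet P).Nonempty := by
      refine nonempty_of_measure_ne_zero (μ := vol) ?_
      rw [measure_inter_conull (ae_iff.1 (ae_mem_goodSet hP))]
      exact hπ.2 (k + 1) (by omega)
    exact ⟨x, hxg, fun j hj => hdomB _ (mem_dom_pow.1 hx j (by omega))⟩)
  refine ⟨m, hm, ?_⟩
  filter_upwards [ae_mem_goodSet hP] with x hx using hid hx

end IGraph

theorem mainTheorem8
    (P : IGraph.I01 × IGraph.I01 ≃ᵐ IGraph.I01) (hP : MeasurePreserving P volume volume)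
    (Ψ : IGraph.Vertex → ℤ) (hΨ : Function.Injective Ψ)
    (𝔪 : IGraph.Microcosm) (h𝔪 : ∀ f ∈ 𝔪.maps, MeasurePreserving f IGraph.vol IGraph.vol)
    {D : Type} [Finite D] (G : IGraph.Graphing D) (hG : IGraph.IsMachine P Ψ 𝔪 G)
    (w : List Bool) {n : ℕ} (ι : Fin (w.length + 1) ↪ Fin (n + 1)) :
    (((IGraph.Project.of 0 G).exec
        (IGraph.Project.of 0 (IGraph.wordRep P Ψ w ι))).OrthTest (IGraph.testNeg Ψ) ↔
      ¬ ∃ π : List (IGraph.Step G (IGraph.tensor (IGraph.wordRep P Ψ w ι) (IGraph.idRej Ψ))),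
          IGraph.IsCycleThrough π (IGraph.rejRegion Ψ)) ∧
    (𝔪.maps ⊆ IGraph.mInfty.maps →
      (((IGraph.Project.of 0 G).exec
          (IGraph.Project.of 0 (IGraph.wordRep P Ψ w ι))).OrthTest (IGraph.testNeg Ψ) ↔
        ¬ ∃ π : List (IGraph.Step G (IGraph.tensor (IGraph.wordRep P Ψ w ι) (IGraph.idRej Ψ))),
            IGraph.IsIterableCycleThrough π (IGraph.rejRegion Ψ))) := by
  have hV : G.V = IGraph.wordSupport Ψ ∪ IGraph.resultSupport Ψ := hG.mem_predType.2.1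
  have hWV : (IGraph.wordRep P Ψ w ι).V = IGraph.wordSupport Ψ := rfl
  have hdisj : Disjoint (IGraph.wordRep P Ψ w ι).V (IGraph.idRej Ψ).V :=
    IGraph.disjoint_wordSupport_resultSupport hΨ
  have hQG : G.IsQMP := fun e => (h𝔪 _ (hG.realisedIn e)).quasiMeasurePreserving
  have hQW : (IGraph.wordRep P Ψ w ι).IsQMP := IGraph.isQMP_wordRep w ι hP
  have hQI := IGraph.isQMP_idRej Ψ
  have hsupp : (G.V \ (IGraph.wordRep P Ψ w ι).V) ∪ ((IGraph.wordRep P Ψ w ι).V \ G.V) =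
      IGraph.resultSupport Ψ := by
    rw [hV, hWV, Set.union_sdiff_left,
      (IGraph.disjoint_wordSupport_resultSupport hΨ).symm.sdiff_eq_left,
      Set.sdiff_eq_empty.2 Set.subset_union_left, Set.union_empty]
  have hcycle : ((IGraph.Project.of 0 G).exec
      (IGraph.Project.of 0 (IGraph.wordRep P Ψ w ι))).OrthTest (IGraph.testNeg Ψ) ↔
      ¬ ∃ π : List (IGraph.Step G (IGraph.tensor (IGraph.wordRep P Ψ w ι) (IGraph.idRej Ψ))),
          IGraph.IsCycleThrough π (IGraph.rejRegion Ψ) := by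
    rw [IGraph.orthTest_testNeg_iff Ψ G _ hG.weight_one (fun _ => rfl) hsupp, ← not_ne_iff,
      IGraph.meas_ne_zero_iff (IGraph.isQMP_exec hQG hQW) hQI
        (fun l => IGraph.weight_eq_one hG.weight_one (fun _ => rfl) l.1) (fun _ => rfl),
      IGraph.exists_loop_exec_iff hQG (IGraph.isQMP_tensor hQW hQI)
        (by rw [hV, hWV]; exact Set.subset_union_left) hdisj,
      IGraph.exists_isCycleThrough_iff (fun _ => subset_rfl)
        (hdisj.mono_right (IGraph.rejRegion_subset_resultSupport Ψ))]
  refine ⟨hcycle, fun hsub => hcycle.trans (not_congr ⟨?_, ?_⟩)⟩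
  · rintro ⟨π, hπ⟩
    exact ⟨π, hπ.isIterable⟩
  · rintro ⟨π, hπ⟩
    obtain ⟨m, hm, hid⟩ := IGraph.exists_iterate_run_ae_eq hP hV
      (fun e => hsub (hG.realisedIn e)) hπ
    exact ⟨_, hπ.isCycleThrough_pow hm hid⟩
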